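/- **Setting.** Let $k\ge 1$, $n>k$ and $0\le t<T$ be integers, let $\gamma>0$ be the coefficient of absolute risk aversion, $W_t\neq 0$ the wealth at time $t$, and $r_{f,i}$ the risk-free returns, with $R_{f,i}=1+r_{f,i}\ne 0$ for $t+1\le i\le T$. Given a mean vector $\mu\in\mathbb R^k$ and a positive definite $k\times k$ covariance matrix $\Sigma$, the asset returns $X_i$ are i.i.d. $\mathcal N_k(\mu,\Sigma)$. With weights $v$ chosen at time $s$, wealth evolves by $W_{s+1}=W_s\bigl(1+r_{f,s+1}+v^\top(X_{s+1}-r_{f,s+1}\mathbf 1)\bigr)$. The investor maximizes the expected exponential utility $\mathbb E[-\exp(-\gamma W_T)]$ through the Bellman equations $V(T,W)=-\exp(-\gamma W)$, $V(s,W_s)=\max_v \mathbb E\,[V(s+1,W_{s+1})]$. The optimal weights at time $t$, i.e. the unique maximizer in the Bellman equation at time $t$, are $$w_t=C_t\,\Sigma^{-1}(\mu-r_{f,t+1}\mathbf 1),\qquad C_t=\Bigl(\gamma W_t\prod_{i=t+2}^{T}R_{f,i}\Bigr)^{-1}.$$ Let $x=(x_1,\dots,x_n)$ be $n$ observed return vectors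 in $\mathbb R^k$, with sample mean $\bar x_t$ and sample covariance matrix $S_t=\frac1{n-1}\sum_{i}(x_i-\bar x_t)(x_i-\bar x_t)^\top$. The posterior distribution of $(\mu,\Sigma)$ given $x$ has a density, with respect to Lebesgue measure in the entries of $\mu$ and the entries $\sigma_{ij}$, $i\le j$, of the positive definite matrix $\Sigma$, that is proportional to the normal likelihood of $x$ times the prior. **Theorem.** In both cases below the posterior is a proper probability distribution, $w_t$ is integrable with respect to it, and its posterior mean (the Bayes estimate of the optimal weights) is as follows. (a) Diffuse prior $\pi(\mu,\Sigma)\propto|\Sigma|^{-(k+1)/2}$: put $\bar x_{t,d}=\bar x_t$ and $S_{t,d}=(n-1)S_t$. If $S_{t,d}$ is nonsingular, then $$\mathbb E(w_t\mid x)=C_t\,(n-1)\,S_{t,d}^{-1}(\bar x_{t,d}-r_{f,t+1}\mathbf 1).$$ (b) Conjugate prior $\mu\mid\Sigma\sim\mathcal N_k(m_0,\Sigma/r_0)$, $\Sigma\sim\mathcal{IW}_k(d_0,S_0)$, where $m_0\in\mathbb R^k$, $r_0>0$, $d_0>2k$, $S_0$ is positive definite, and $\mathcal{IW}_k(d_0,S_0)$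 is the inverse Wishart distribution with density proportional to $|\Sigma|^{-d_0/2}\exp(-\tfrac12\operatorname{tr}(\Sigma^{-1}S_0))$: put $$\bar x_{t,c}=\frac{n\bar x_t+r_0m_0}{n+r_0},\qquad S_{t,c}=S_{t,d}+S_0+\frac{nr_0}{n+r_0}(m_0-\bar x_t)(m_0-\bar x_t)^\top.$$ Then $$\mathbb E(w_t\mid x)=C_t\,(n+d_0-k-1)\,S_{t,c}^{-1}(\bar x_{t,c}-r_{f,t+1}\mathbf 1).$$ -/

import Mathlib

open MeasureTheory ProbabilityTheory
open scoped Matrix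

namespace BayesPortfolio

noncomputable section

/-! ### The multi-period portfolio choice problem -/

/-- Wealth after one period: from wealth `W`, with risky weights `v`, risk-free return `rf` and
risky returns `y`, the new wealth is `W (1 + rf + vᵀ (y - rf 1))`. -/
def nextWealth {k : ℕ} (rf W : ℝ) (v y : Fin k → ℝ) : ℝ :=
  W * (1 + rf + v ⬝ᵥ fun i => y i - rf)

/-- The value function with `j` periods to go before the horizon `T`, i.e. at time `T - j`, when
the returns are i.i.d. `N_k(μ, Σ)`, given by the Bellman recursion
`V(T, W) = - exp (-γ W)` and
`V(s, W) = sup_v E[V(s + 1, W (1 + r_{s+1} + vᵀ (X_{s+1} - r_{s+1} 1)))]`. -/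
def valueFn {k : ℕ} (γ : ℝ) (r : ℕ → ℝ) (T : ℕ) (μ : Fin k → ℝ) (Sig : Matrix (Fin k) (Fin k) ℝ) :
    ℕ → ℝ → ℝ
  | 0, W => -Real.exp (-γ * W)
  | j + 1, W => ⨆ v : Fin k → ℝ,
      ∫ y, valueFn γ r T μ Sig j (nextWealth (r (T - j)) W v y.ofLp)
        ∂(multivariateGaussian (WithLp.toLp 2 μ) Sig)

/-- `E_t[V(t + 1, W_{t+1})]` when the weights `v` are chosen at time `t < T` with wealth `W`. -/
def objective {k : ℕ} (γ : ℝ) (r : ℕ → ℝ) (T t : ℕ) (W : ℝ) (μ : Fin k → ℝ)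
    (Sig : Matrix (Fin k) (Fin k) ℝ) (v : Fin k → ℝ) : ℝ :=
  ∫ y, valueFn γ r T μ Sig (T - (t + 1)) (nextWealth (r (t + 1)) W v y.ofLp)
    ∂(multivariateGaussian (WithLp.toLp 2 μ) Sig)

/-- `v` is an optimal vector of weights at time `t`: it attains the maximum in the Bellman
equation. -/
def IsOptimalWeight {k : ℕ} (γ : ℝ) (r : ℕ → ℝ) (T t : ℕ) (W : ℝ) (μ : Fin k → ℝ)
    (Sig : Matrix (Fin k) (Fin k) ℝ) (v : Fin k → ℝ) : Prop :=
  ∀ v' : Fin k → ℝ, objective γ r T t W μ Sig v' ≤ objective γ r T t W μ Sig v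

/-- `C_t = (γ W_t ∏_{i=t+2}^T R_i)⁻¹` with `R_i = 1 + r_i`. -/
def coefC (γ : ℝ) (r : ℕ → ℝ) (T t : ℕ) (W : ℝ) : ℝ :=
  (γ * W * ∏ i ∈ Finset.Icc (t + 2) T, (1 + r i))⁻¹

/-- `w_t = C_t Σ⁻¹ (μ - r_{t+1} 1)`. -/
def weight {k : ℕ} (γ : ℝ) (r : ℕ → ℝ) (T t : ℕ) (W : ℝ) (μ : Fin k → ℝ)
    (Sig : Matrix (Fin k) (Fin k) ℝ) : Fin k → ℝ :=
  coefC γ r T t W • (Sig⁻¹ *ᵥ fun i => μ i - r (t + 1))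

/-! ### The space of parameters `(μ, Σ)` -/

/-- A symmetric matrix is given by its entries on and above the diagonal. -/
abbrev SymCoord (k : ℕ) : Type := {p : Fin k × Fin k // p.1 ≤ p.2} → ℝ

/-- The symmetric matrix with the given entries on and above the diagonal. -/
def symMatrix {k : ℕ} (s : SymCoord k) : Matrix (Fin k) (Fin k) ℝ :=
  Matrix.of fun i j => s ⟨(min i j, max i j), min_le_max⟩

/-- The measure `dμ dΣ` on pairs of a vector `μ` and a positive definite matrix `Σ`: Lebesgue
measure in the entries of `μ` and the entries `σ_ij`, `i ≤ j`, of `Σ`. -/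
def paramMeasure (k : ℕ) : Measure ((Fin k → ℝ) × SymCoord k) :=
  (volume : Measure ((Fin k → ℝ) × SymCoord k)).restrict {θ | (symMatrix θ.2).PosDef}

/-! ### Likelihood, priors and posterior -/

/-- The density of `N_k(m, S)` for positive definite `S`. -/
def gaussianDensity {k : ℕ} (m : Fin k → ℝ) (S : Matrix (Fin k) (Fin k) ℝ) (y : Fin k → ℝ) : ℝ :=
  (2 * Real.pi) ^ (-(k : ℝ) / 2) * S.det ^ (-(1 : ℝ) / 2) *
    Real.exp (-((y - m) ⬝ᵥ (S⁻¹ *ᵥ (y - m))) / 2)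

/-- The likelihood of `n` observations that are i.i.d. `N_k(μ, Σ)`. -/
def likelihood {k n : ℕ} (x : Fin n → Fin k → ℝ) (μ : Fin k → ℝ)
    (Sig : Matrix (Fin k) (Fin k) ℝ) : ℝ :=
  ∏ i, gaussianDensity μ Sig (x i)

/-- The diffuse prior `|Σ|^{-(k+1)/2}` (an improper density, up to a constant factor). -/
def diffusePrior {k : ℕ} (_μ : Fin k → ℝ) (Sig : Matrix (Fin k) (Fin k) ℝ) : ℝ :=
  Sig.det ^ (-((k : ℝ) + 1) / 2)

/-- The multivariate gamma function `Γ_k(a)`. -/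
def multiGamma (k : ℕ) (a : ℝ) : ℝ :=
  Real.pi ^ ((k : ℝ) * ((k : ℝ) - 1) / 4) * ∏ i : Fin k, Real.Gamma (a - (i : ℝ) / 2)

/-- The density of the inverse Wishart distribution `IW_k(d, S)`, `d > 2k`, in the parametrization
with density proportional to `|Σ|^{-d/2} exp(-tr(Σ⁻¹ S)/2)`; then
`Σ⁻¹` is Wishart with `d - k - 1` degrees of freedom and scale matrix `S⁻¹`. -/
def invWishartDensity {k : ℕ} (d : ℝ) (S Sig : Matrix (Fin k) (Fin k) ℝ) : ℝ :=
  S.det ^ ((d - k - 1) / 2) /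
      (2 ^ ((k : ℝ) * (d - k - 1) / 2) * multiGamma k ((d - k - 1) / 2)) *
    Sig.det ^ (-d / 2) * Real.exp (-(Sig⁻¹ * S).trace / 2)

/-- The conjugate prior `μ | Σ ∼ N_k(m₀, Σ / r₀)`, `Σ ∼ IW_k(d₀, S₀)`. -/
def conjugatePrior {k : ℕ} (m₀ : Fin k → ℝ) (r₀ d₀ : ℝ) (S₀ : Matrix (Fin k) (Fin k) ℝ)
    (μ : Fin k → ℝ) (Sig : Matrix (Fin k) (Fin k) ℝ) : ℝ :=
  gaussianDensity m₀ (r₀⁻¹ • Sig) μ * invWishartDensity d₀ S₀ Sig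

/-- The measure with density `L(x | μ, Σ) π(μ, Σ)`. -/
def unnormPosterior {k n : ℕ} (prior : (Fin k → ℝ) → Matrix (Fin k) (Fin k) ℝ → ℝ)
    (x : Fin n → Fin k → ℝ) : Measure ((Fin k → ℝ) × SymCoord k) :=
  (paramMeasure k).withDensity fun θ =>
    ENNReal.ofReal (likelihood x θ.1 (symMatrix θ.2) * prior θ.1 (symMatrix θ.2))

/-- The posterior distribution of `(μ, Σ)` given the data `x`, by Bayes' theorem: its density is
proportional to likelihood times prior. -/
def posterior {k n : ℕ} (prior : (Fin k → ℝ) → Matrix (Fin k) (Fin k) ℝ → ℝ)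
    (x : Fin n → Fin k → ℝ) : Measure ((Fin k → ℝ) × SymCoord k) :=
  (unnormPosterior prior x Set.univ)⁻¹ • unnormPosterior prior x

/-- `g(μ, Σ)` has posterior mean `b`: the posterior is a proper probability distribution, the
function is integrable with respect to it, and its expectation is `b`. -/
def HasPosteriorMean {k n : ℕ} (prior : (Fin k → ℝ) → Matrix (Fin k) (Fin k) ℝ → ℝ)
    (x : Fin n → Fin k → ℝ) (g : (Fin k → ℝ) → Matrix (Fin k) (Fin k) ℝ → Fin k → ℝ)
    (b : Fin k → ℝ) : Prop :=
  IsProbabilityMeasure (posterior prior x) ∧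
    Integrable (fun θ => g θ.1 (symMatrix θ.2)) (posterior prior x) ∧
    ∫ θ, g θ.1 (symMatrix θ.2) ∂(posterior prior x) = b

/-! ### Statistics of the data -/

/-- The sample mean `x̄_t`; this is also `x̄_{t,d}`. -/
def sampleMean {k n : ℕ} (x : Fin n → Fin k → ℝ) : Fin k → ℝ :=
  (n : ℝ)⁻¹ • ∑ i, x i

/-- The sample covariance matrix `S_t`. -/
def sampleCov {k n : ℕ} (x : Fin n → Fin k → ℝ) : Matrix (Fin k) (Fin k) ℝ :=
  ((n : ℝ) - 1)⁻¹ •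
    ∑ i, Matrix.vecMulVec (x i - sampleMean x) (x i - sampleMean x)

/-- `S_{t,d} = (n - 1) S_t`. -/
def scatterD {k n : ℕ} (x : Fin n → Fin k → ℝ) : Matrix (Fin k) (Fin k) ℝ :=
  ((n : ℝ) - 1) • sampleCov x

/-- `x̄_{t,c} = (n x̄_t + r₀ m₀) / (n + r₀)`. -/
def meanC {k n : ℕ} (m₀ : Fin k → ℝ) (r₀ : ℝ) (x : Fin n → Fin k → ℝ) : Fin k → ℝ :=
  ((n : ℝ) + r₀)⁻¹ • ((n : ℝ) • sampleMean x + r₀ • m₀)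

/-- `S_{t,c} = S_{t,d} + S₀ + n r₀ (m₀ - x̄_t)(m₀ - x̄_t)ᵀ / (n + r₀)`. -/
def scatterC {k n : ℕ} (m₀ : Fin k → ℝ) (r₀ : ℝ) (S₀ : Matrix (Fin k) (Fin k) ℝ)
    (x : Fin n → Fin k → ℝ) : Matrix (Fin k) (Fin k) ℝ :=
  scatterD x + S₀ +
    ((n : ℝ) * r₀ / ((n : ℝ) + r₀)) • Matrix.vecMulVec (m₀ - sampleMean x) (m₀ - sampleMean x)

end

end BayesPortfolio

open BayesPortfolio

namespace BayesPortfolio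

/-! ### The optimal weights -/

/-! Optimal weights. Exponential utility is reproduced by the Bellman recursion: off zero wealth,
each value function is `-A * exp (-c * w)` with `A > 0` and `c` equal to `γ` times the remaining
risk-free factors (`valueFn_eq`). The Gaussian moment generating function makes the expected utility
a decreasing function of a positive definite quadratic in the weights, and completing the square
gives its unique optimum (`isOptimalWeight_iff`).

Posterior means. For either prior, likelihood times prior is a constant multiple of one
normal-inverse-Wishart kernel `niwDensity κ m S d`, with `(κ, d) = (n, n + k)` or `(n + r₀, n +
d₀)`. The affine maps `(μ, Σ) ↦ (m + A μ, A Σ Aᵀ)` permute these kernels up to constants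
(`map_paramMap_niwMeasure`), so writing `S = A Aᵀ` reduces everything to `m = 0`, `S = 1`. There
`Σ⁻¹ μ` has mean zero by the symmetry `μ ↦ -μ`. Invariance under sign changes and transpositions of
coordinates forces the mean of `Σ⁻¹` to be scalar.

The scalar comes from homogeneity, without computing a normalising constant: the total mass for `S =
t • 1` is proportional to `t ^ (-k (d - k - 1) / 2)`, and it is also the Laplace transform of `tr
Σ⁻¹` at `t / 2`. Differentiating at `t = 1` gives mean trace `k (d - k - 1)` (`integral_trace_inv`).

The remaining analytic input is that the mass is finite for `d > 2k` (`niwMeasure_one_lt_top`). It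
is proved by induction on `k`, splitting off one row through its Schur complement and regression
coefficients. -/

lemma map_dotProduct_multivariateGaussian {k : ℕ} (μ : Fin k → ℝ)
    {S : Matrix (Fin k) (Fin k) ℝ} (hS : S.PosSemidef) (v : Fin k → ℝ) :
    (multivariateGaussian (WithLp.toLp 2 μ) S).map (fun y => v ⬝ᵥ y.ofLp) =
      gaussianReal (v ⬝ᵥ μ) (v ⬝ᵥ S *ᵥ v).toNNReal := by
  have hfun : (fun y : EuclideanSpace ℝ (Fin k) => v ⬝ᵥ y.ofLp) =
      fun y => inner ℝ (WithLp.toLp 2 v) y := by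
    ext y
    simp [PiLp.inner_apply, dotProduct, mul_comm]
  have hmap := IsGaussian.map_eq_gaussianReal
    (μ := multivariateGaussian (WithLp.toLp 2 μ) S) (innerSL ℝ (WithLp.toLp 2 v))
  have hmem : MemLp id 2 (multivariateGaussian (WithLp.toLp 2 μ) S) := IsGaussian.memLp_two_id
  rw [hfun]
  have hint : ∫ y, innerSL ℝ (WithLp.toLp 2 v) y ∂(multivariateGaussian (WithLp.toLp 2 μ) S)
      = v ⬝ᵥ μ := by
    have h := (innerSL ℝ (WithLp.toLp 2 v)).integral_comp_comm (hmem.integrable (by norm_num))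
    simp only [id_eq] at h
    rw [h]
    simp [PiLp.inner_apply, dotProduct, mul_comm]
  have hvar : Var[⇑(innerSL ℝ (WithLp.toLp 2 v)); multivariateGaussian (WithLp.toLp 2 μ) S] =
      v ⬝ᵥ S *ᵥ v := by
    have := covarianceBilin_self hmem (WithLp.toLp 2 v)
    rw [covarianceBilin_multivariateGaussian hS] at this
    exact this.symm
  rw [hint, hvar] at hmap
  exact hmap

lemma PosDef_dotProduct_mulVec_pos {k : ℕ} {S : Matrix (Fin k) (Fin k) ℝ} (hS : S.PosDef)
    {v : Fin k → ℝ} (hv : v ≠ 0) : 0 < v ⬝ᵥ S *ᵥ v := by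
  simpa using hS.dotProduct_mulVec_pos hv

lemma integral_exp_dotProduct {k : ℕ} (μ : Fin k → ℝ) {S : Matrix (Fin k) (Fin k) ℝ}
    (hS : S.PosSemidef) (v : Fin k → ℝ) (a : ℝ) :
    ∫ y, Real.exp (a * (v ⬝ᵥ y.ofLp)) ∂(multivariateGaussian (WithLp.toLp 2 μ) S) =
      Real.exp (a * (v ⬝ᵥ μ) + a ^ 2 / 2 * (v ⬝ᵥ S *ᵥ v)) := by
  have h := mgf_gaussianReal (map_dotProduct_multivariateGaussian μ hS v) a
  have h0 : 0 ≤ v ⬝ᵥ S *ᵥ v := by simpa using hS.dotProduct_mulVec_nonneg v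
  rw [mgf] at h
  rw [h, Real.coe_toNNReal _ h0]
  congr 1; ring

lemma dotProduct_sub_const {k : ℕ} (v y : Fin k → ℝ) (c : ℝ) :
    (v ⬝ᵥ fun i => y i - c) = v ⬝ᵥ y - v ⬝ᵥ fun _ => c := by
  rw [← dotProduct_sub]; rfl

/-- The exponential form of the value function is available only off zero wealth, so zero must be
negligible. For `v ≠ 0`, the law of `vᵀ X` is Gaussian with positive variance and has no atoms; for
`v = 0` the next wealth is the constant `W (1 + rf)`. -/
lemma nextWealth_ne_zero_ae {k : ℕ} (μ : Fin k → ℝ) {S : Matrix (Fin k) (Fin k) ℝ}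
    (hS : S.PosDef) {rf W : ℝ} (hW : W ≠ 0) (hrf : 1 + rf ≠ 0) (v : Fin k → ℝ) :
    ∀ᵐ y ∂(multivariateGaussian (WithLp.toLp 2 μ) S), nextWealth rf W v y.ofLp ≠ 0 := by
  by_cases hv : v = 0
  · subst hv
    exact Filter.Eventually.of_forall fun y => by simp [nextWealth, hW, hrf]
  have hpos := PosDef_dotProduct_mulVec_pos hS hv
  have hns := nullSingletonClass_gaussianReal (μ := v ⬝ᵥ μ) (v := (v ⬝ᵥ S *ᵥ v).toNNReal)
    (by simpa using hpos)
  rw [← map_dotProduct_multivariateGaussian μ hS.posSemidef v] at hns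
  have h0 := hns.measure_singleton ((v ⬝ᵥ fun _ => rf) - (1 + rf))
  have hmeas : Measurable fun y : EuclideanSpace ℝ (Fin k) => v ⬝ᵥ y.ofLp := by
    unfold dotProduct; fun_prop
  rw [Measure.map_apply hmeas (measurableSet_singleton _)] at h0
  refine measure_mono_null (fun y hy => ?_) h0
  simp only [Set.mem_ofPred_eq, Set.mem_compl_iff, not_not, nextWealth, mul_eq_zero, hW,
    false_or, dotProduct_sub_const] at hy
  simp only [Set.mem_preimage, Set.mem_singleton_iff]
  linarith

/-- The exponent of the expected utility, as a function of the weights. -/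
lemma integral_exponential_utility {k : ℕ} (μ : Fin k → ℝ) {S : Matrix (Fin k) (Fin k) ℝ}
    (hS : S.PosDef) {rf W A c : ℝ} (hW : W ≠ 0) (hrf : 1 + rf ≠ 0) {f : ℝ → ℝ}
    (hf : ∀ w, w ≠ 0 → f w = -A * Real.exp (-c * w)) (v : Fin k → ℝ) :
    ∫ y, f (nextWealth rf W v y.ofLp) ∂(multivariateGaussian (WithLp.toLp 2 μ) S) =
      -A * Real.exp (-c * W * (1 + rf) +
        (-(c * W) * (v ⬝ᵥ fun i => μ i - rf) + (c * W) ^ 2 / 2 * (v ⬝ᵥ S *ᵥ v))) := by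
  have h1 : ∀ᵐ y ∂(multivariateGaussian (WithLp.toLp 2 μ) S),
      f (nextWealth rf W v y.ofLp) =
        (-A * Real.exp (-c * W * (1 + rf - v ⬝ᵥ fun _ => rf))) *
          Real.exp (-(c * W) * (v ⬝ᵥ y.ofLp)) := by
    filter_upwards [nextWealth_ne_zero_ae μ hS hW hrf v] with y hy
    rw [hf _ hy, mul_assoc, ← Real.exp_add, nextWealth, dotProduct_sub_const]
    congr 2; ring
  rw [integral_congr_ae h1, integral_const_mul, integral_exp_dotProduct μ hS.posSemidef,
    mul_assoc, ← Real.exp_add, dotProduct_sub_const]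
  congr 2; ring

lemma dotProduct_mulVec_comm_of_posDef {k : ℕ} {S : Matrix (Fin k) (Fin k) ℝ} (hS : S.PosDef)
    (u v : Fin k → ℝ) : u ⬝ᵥ S *ᵥ v = v ⬝ᵥ S *ᵥ u := by
  have hT : Sᵀ = S := by simpa using hS.isHermitian.eq
  rw [Matrix.dotProduct_mulVec, ← Matrix.mulVec_transpose, hT, dotProduct_comm]

lemma mulVec_inv_mulVec_of_posDef {k : ℕ} {S : Matrix (Fin k) (Fin k) ℝ} (hS : S.PosDef)
    (m : Fin k → ℝ) : S *ᵥ (S⁻¹ *ᵥ m) = m := by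
  rw [Matrix.mulVec_mulVec, Matrix.mul_nonsing_inv _ (isUnit_iff_ne_zero.2 hS.det_pos.ne'),
    Matrix.one_mulVec]

/-- Completing the square in the exponent of the expected utility. -/
lemma quadratic_eq_square {k : ℕ} {S : Matrix (Fin k) (Fin k) ℝ} (hS : S.PosDef)
    (m v : Fin k → ℝ) {b : ℝ} (hb : b ≠ 0) :
    -b * (v ⬝ᵥ m) + b ^ 2 / 2 * (v ⬝ᵥ S *ᵥ v) =
      b ^ 2 / 2 * ((v - b⁻¹ • S⁻¹ *ᵥ m) ⬝ᵥ S *ᵥ (v - b⁻¹ • S⁻¹ *ᵥ m)) -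
        1 / 2 * (m ⬝ᵥ S⁻¹ *ᵥ m) := by
  have h1 : S *ᵥ (b⁻¹ • S⁻¹ *ᵥ m) = b⁻¹ • m := by
    rw [Matrix.mulVec_smul, mulVec_inv_mulVec_of_posDef hS]
  have h2 : (b⁻¹ • S⁻¹ *ᵥ m) ⬝ᵥ S *ᵥ v = b⁻¹ * (v ⬝ᵥ m) := by
    rw [dotProduct_mulVec_comm_of_posDef hS, h1, dotProduct_smul, smul_eq_mul]
  rw [Matrix.mulVec_sub, dotProduct_sub, sub_dotProduct, sub_dotProduct, h1, h2, dotProduct_smul,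
    dotProduct_smul, smul_dotProduct, dotProduct_comm (S⁻¹ *ᵥ m)]
  simp only [smul_eq_mul]
  field_simp
  ring

lemma quadratic_min {k : ℕ} {S : Matrix (Fin k) (Fin k) ℝ} (hS : S.PosDef)
    (m v : Fin k → ℝ) {b : ℝ} (hb : b ≠ 0) :
    -(1 / 2 * (m ⬝ᵥ S⁻¹ *ᵥ m)) ≤ -b * (v ⬝ᵥ m) + b ^ 2 / 2 * (v ⬝ᵥ S *ᵥ v) := by
  rw [quadratic_eq_square hS m v hb]
  have : 0 ≤ (v - b⁻¹ • S⁻¹ *ᵥ m) ⬝ᵥ S *ᵥ (v - b⁻¹ • S⁻¹ *ᵥ m) := by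
    simpa using hS.posSemidef.dotProduct_mulVec_nonneg (v - b⁻¹ • S⁻¹ *ᵥ m)
  nlinarith [sq_nonneg b, mul_nonneg (sq_nonneg b) this]

lemma quadratic_eq_min_iff {k : ℕ} {S : Matrix (Fin k) (Fin k) ℝ} (hS : S.PosDef)
    (m v : Fin k → ℝ) {b : ℝ} (hb : b ≠ 0) :
    -b * (v ⬝ᵥ m) + b ^ 2 / 2 * (v ⬝ᵥ S *ᵥ v) = -(1 / 2 * (m ⬝ᵥ S⁻¹ *ᵥ m)) ↔
      v = b⁻¹ • S⁻¹ *ᵥ m := by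
  rw [quadratic_eq_square hS m v hb]
  constructor
  · intro h
    by_contra hne
    have := PosDef_dotProduct_mulVec_pos hS (sub_ne_zero.2 hne)
    have hb2 : 0 < b ^ 2 / 2 := by positivity
    nlinarith [mul_pos hb2 this]
  · intro h
    rw [h]; simp

/-- Each Bellman step multiplies the exponent rate by `1 + r (T - j)` and the constant by a factor
independent of `w`. Zero wealth is excluded because it stays zero under every choice of weights, so
its value is not given by the same `A`. -/
lemma valueFn_eq {k : ℕ} (μ : Fin k → ℝ) {S : Matrix (Fin k) (Fin k) ℝ} (hS : S.PosDef)
    (γ : ℝ) (hγ : 0 < γ) (r : ℕ → ℝ) (T t : ℕ) (hr : ∀ i ∈ Finset.Icc (t + 1) T, 1 + r i ≠ 0)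
    (j : ℕ) (hj : t + j ≤ T) :
    ∃ A : ℝ, 0 < A ∧ ∀ w : ℝ, w ≠ 0 → valueFn γ r T μ S j w =
      -A * Real.exp (-(γ * ∏ i ∈ Finset.Icc (T - j + 1) T, (1 + r i)) * w) := by
  induction j with
  | zero => exact ⟨1, one_pos, fun w _ => by simp [valueFn]⟩
  | succ j ih =>
    obtain ⟨A, hA, hf⟩ := ih (by omega)
    have hR : 1 + r (T - j) ≠ 0 := hr _ (Finset.mem_Icc.2 ⟨by omega, by omega⟩)
    have hprod : ∏ i ∈ Finset.Icc (T - (j + 1) + 1) T, (1 + r i) =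
        (1 + r (T - j)) * ∏ i ∈ Finset.Icc (T - j + 1) T, (1 + r i) := by
      rw [show T - (j + 1) + 1 = T - j by omega, ← Finset.mul_prod_Ioc_eq_prod_Icc (by omega)]
      congr 2
      ext i
      simp only [Finset.mem_Ioc, Finset.mem_Icc]
      omega
    have hP : ∏ i ∈ Finset.Icc (T - j + 1) T, (1 + r i) ≠ 0 :=
      Finset.prod_ne_zero_iff.2 fun i hi => by
        rw [Finset.mem_Icc] at hi
        exact hr i (Finset.mem_Icc.2 ⟨by omega, hi.2⟩)
    set P := ∏ i ∈ Finset.Icc (T - j + 1) T, (1 + r i)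
    set m : Fin k → ℝ := fun i => μ i - r (T - j)
    -- The new factor is the exponential of the minimum of the quadratic in `v`; that minimum does
    -- not depend on `w`.
    refine ⟨A * Real.exp (-(1 / 2 * (m ⬝ᵥ S⁻¹ *ᵥ m))), by positivity, fun w hw => ?_⟩
    have hb : γ * P * w ≠ 0 := mul_ne_zero (mul_ne_zero hγ.ne' hP) hw
    have hval : ∀ v : Fin k → ℝ,
        ∫ y, valueFn γ r T μ S j (nextWealth (r (T - j)) w v y.ofLp)
          ∂(multivariateGaussian (WithLp.toLp 2 μ) S) = _ :=
      fun v => integral_exponential_utility μ hS hw hR hf v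
    simp only [valueFn, hval]
    have hrhs : -(A * Real.exp (-(1 / 2 * (m ⬝ᵥ S⁻¹ *ᵥ m)))) *
        Real.exp (-(γ * ∏ i ∈ Finset.Icc (T - (j + 1) + 1) T, (1 + r i)) * w) =
        -A * Real.exp (-(γ * P) * w * (1 + r (T - j)) + -(1 / 2 * (m ⬝ᵥ S⁻¹ *ᵥ m))) := by
      rw [hprod, Real.exp_add, show -(γ * P) * w * (1 + r (T - j)) =
        -(γ * ((1 + r (T - j)) * P)) * w by ring]
      ring
    rw [hrhs]
    apply IsLUB.ciSup_eq
    -- The supremum is attained, so a greatest element settles the real `⨆` with no separate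
    -- boundedness argument.
    refine IsGreatest.isLUB ⟨⟨(γ * P * w)⁻¹ • S⁻¹ *ᵥ m, ?_⟩, ?_⟩
    · have := (quadratic_eq_min_iff hS m _ hb).2 rfl
      simp only
      rw [this]
    · rintro _ ⟨v, rfl⟩
      have := quadratic_min hS m v hb
      simp only [neg_mul, neg_le_neg_iff]
      refine mul_le_mul_of_nonneg_left (Real.exp_le_exp.2 ?_) hA.le
      simp only [neg_mul] at this
      linarith

theorem isOptimalWeight_iff {k : ℕ} (μ : Fin k → ℝ) {S : Matrix (Fin k) (Fin k) ℝ}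
    (hS : S.PosDef) {γ W : ℝ} (hγ : 0 < γ) (hW : W ≠ 0) {r : ℕ → ℝ} {T t : ℕ} (ht : t < T)
    (hr : ∀ i ∈ Finset.Icc (t + 1) T, 1 + r i ≠ 0) (v : Fin k → ℝ) :
    IsOptimalWeight γ r T t W μ S v ↔ v = weight γ r T t W μ S := by
  obtain ⟨A, hA, hf⟩ := valueFn_eq μ hS γ hγ r T t hr (T - (t + 1)) (by omega)
  rw [show T - (T - (t + 1)) + 1 = t + 2 by omega] at hf
  have hR : 1 + r (t + 1) ≠ 0 := hr _ (Finset.mem_Icc.2 ⟨le_rfl, by omega⟩)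
  have hP : ∏ i ∈ Finset.Icc (t + 2) T, (1 + r i) ≠ 0 :=
    Finset.prod_ne_zero_iff.2 fun i hi => by
      rw [Finset.mem_Icc] at hi
      exact hr i (Finset.mem_Icc.2 ⟨by omega, hi.2⟩)
  have hobj : ∀ v, objective γ r T t W μ S v = _ :=
    fun v => integral_exponential_utility μ hS hW hR hf v
  rw [weight, coefC, show γ * W * ∏ i ∈ Finset.Icc (t + 2) T, (1 + r i) =
    γ * (∏ i ∈ Finset.Icc (t + 2) T, (1 + r i)) * W by ring]
  set P := ∏ i ∈ Finset.Icc (t + 2) T, (1 + r i)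
  set m : Fin k → ℝ := fun i => μ i - r (t + 1)
  have hb : γ * P * W ≠ 0 := mul_ne_zero (mul_ne_zero hγ.ne' hP) hW
  rw [← quadratic_eq_min_iff hS m v hb]
  have hle : ∀ v v', objective γ r T t W μ S v' ≤ objective γ r T t W μ S v ↔
      -(γ * P * W) * (v ⬝ᵥ m) + (γ * P * W) ^ 2 / 2 * (v ⬝ᵥ S *ᵥ v) ≤
      -(γ * P * W) * (v' ⬝ᵥ m) + (γ * P * W) ^ 2 / 2 * (v' ⬝ᵥ S *ᵥ v') := fun v v' => by
    rw [hobj, hobj, neg_mul A, neg_mul A, neg_le_neg_iff, mul_le_mul_iff_right₀ hA, Real.exp_le_exp,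
      add_le_add_iff_left]
  constructor
  · intro h
    refine le_antisymm ?_ (quadratic_min hS m v hb)
    refine ((hle v _).1 (h ((γ * P * W)⁻¹ • S⁻¹ *ᵥ m))).trans ?_
    exact ((quadratic_eq_min_iff hS m _ hb).2 rfl).le
  · intro h v'
    rw [hle, h]
    exact quadratic_min hS m v' hb

/-! ### Symmetric matrices in coordinates -/

section SymMatrix

variable {k : ℕ}

lemma symMatrix_apply (s : SymCoord k) (i j : Fin k) :
    symMatrix s i j = s ⟨(min i j, max i j), min_le_max⟩ := rfl

lemma symMatrix_transpose (s : SymCoord k) : (symMatrix s)ᵀ = symMatrix s := by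
  ext i j
  simp only [Matrix.transpose_apply, symMatrix_apply, min_comm, max_comm]

lemma symMatrix_isHermitian (s : SymCoord k) : (symMatrix s).IsHermitian := by
  rw [Matrix.IsHermitian, Matrix.conjTranspose_eq_transpose_of_trivial, symMatrix_transpose]

/-- The entries on and above the diagonal. -/
def symCoord (M : Matrix (Fin k) (Fin k) ℝ) : SymCoord k := fun p => M p.1.1 p.1.2

lemma symMatrix_symCoord {M : Matrix (Fin k) (Fin k) ℝ} (hM : Mᵀ = M) :
    symMatrix (symCoord M) = M := by
  ext i j
  rw [symMatrix_apply, symCoord]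
  rcases le_total i j with h | h
  · simp [h]
  · simp only [h, inf_of_le_right, sup_of_le_left]
    rw [← Matrix.transpose_apply M, hM]

lemma symCoord_symMatrix (s : SymCoord k) : symCoord (symMatrix s) = s := by
  ext ⟨⟨i, j⟩, h⟩
  have h : i ≤ j := h
  simp [symCoord, symMatrix_apply, h]

/-- The action `Σ ↦ A Σ Aᵀ` in coordinates. -/
noncomputable def symConj (A : Matrix (Fin k) (Fin k) ℝ) : SymCoord k →ₗ[ℝ] SymCoord k where
  toFun s := symCoord (A * symMatrix s * Aᵀ)
  map_add' s s' := by
    have : symMatrix (s + s') = symMatrix s + symMatrix s' := rfl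
    ext p
    simp [symCoord, this, mul_add, add_mul]
  map_smul' c s := by
    have : symMatrix (c • s) = c • symMatrix s := rfl
    ext p
    simp [symCoord, this]

lemma symMatrix_symConj (A : Matrix (Fin k) (Fin k) ℝ) (s : SymCoord k) :
    symMatrix (symConj A s) = A * symMatrix s * Aᵀ := by
  refine symMatrix_symCoord (M := A * symMatrix s * Aᵀ) ?_
  simp [Matrix.transpose_mul, symMatrix_transpose, mul_assoc]

lemma symMatrix_injective : Function.Injective (symMatrix : SymCoord k → _) := fun s s' h => by
  rw [← symCoord_symMatrix s, h, symCoord_symMatrix]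

/-- `symConj A⁻¹` is an inverse. For general `A` only nonvanishing matters, since the Jacobian
cancels on normalising; its value is needed for scalar matrices alone. -/
lemma det_symConj_ne_zero {A : Matrix (Fin k) (Fin k) ℝ} (hA : A.det ≠ 0) :
    LinearMap.det (symConj A) ≠ 0 := by
  have hu : IsUnit A.det := isUnit_iff_ne_zero.2 hA
  have h : symConj A ∘ₗ symConj A⁻¹ = LinearMap.id := by
    refine LinearMap.ext fun s => ?_
    apply symMatrix_injective
    simp only [LinearMap.comp_apply, symMatrix_symConj, LinearMap.id_apply]
    rw [← mul_assoc, ← mul_assoc, Matrix.mul_nonsing_inv _ hu, one_mul, mul_assoc,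
      ← Matrix.transpose_mul, Matrix.mul_nonsing_inv _ hu, Matrix.transpose_one, mul_one]
  have := congrArg LinearMap.det h
  rw [LinearMap.det_comp, LinearMap.det_id] at this
  exact left_ne_zero_of_mul_eq_one this

lemma symConj_smul_one (c : ℝ) :
    symConj (c • (1 : Matrix (Fin k) (Fin k) ℝ)) = (c ^ 2) • LinearMap.id := by
  refine LinearMap.ext fun s => ?_
  apply symMatrix_injective
  rw [symMatrix_symConj]
  ext i j
  simp [symMatrix_apply, sq, mul_assoc]

/-- Ordered index pairs `i ≤ j` correspond to unordered pairs, counted by `Sym2.card`. -/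
lemma two_mul_card_symIndex (k : ℕ) :
    2 * (Fintype.card {p : Fin k × Fin k // p.1 ≤ p.2} : ℝ) = k * (k + 1) := by
  rw [← Fintype.card_congr (Sym2.sortEquiv (α := Fin k)), Sym2.card, Fintype.card_fin,
    Nat.cast_choose_two]
  push_cast
  ring

lemma det_symConj_smul_one {t : ℝ} (ht : 0 < t) :
    LinearMap.det (symConj (Real.sqrt t • (1 : Matrix (Fin k) (Fin k) ℝ))) =
      t ^ ((k : ℝ) * (k + 1) / 2) := by
  rw [symConj_smul_one, LinearMap.det_smul, LinearMap.det_id, mul_one, Real.sq_sqrt ht.le,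
    Module.finrank_fintype_fun_eq_card, ← Real.rpow_natCast, ← two_mul_card_symIndex]
  congr 1; ring

lemma continuous_symMatrix : Continuous (symMatrix : SymCoord k → _) :=
  continuous_matrix fun i j => by
    simp only [symMatrix_apply]
    fun_prop

/-- By homogeneity the unit sphere suffices; its compactness then yields openness of the positive
definite cone. -/
lemma posDef_symMatrix_iff (s : SymCoord k) :
    (symMatrix s).PosDef ↔
      ∀ v ∈ Metric.sphere (0 : Fin k → ℝ) 1, 0 < v ⬝ᵥ symMatrix s *ᵥ v := by
  constructor
  · intro h v hv
    refine PosDef_dotProduct_mulVec_pos h ?_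
    rintro rfl
    simp at hv
  · intro h
    refine Matrix.PosDef.of_dotProduct_mulVec_pos (symMatrix_isHermitian s) fun v hv => ?_
    have hn : 0 < ‖v‖ := norm_pos_iff.2 hv
    have := h (‖v‖⁻¹ • v) (by simp [norm_smul, hn.ne'])
    rw [Matrix.mulVec_smul, dotProduct_smul, smul_dotProduct, smul_smul, smul_eq_mul] at this
    simpa using (pos_iff_pos_of_mul_pos this).1 (by positivity)

lemma isOpen_posDef : IsOpen {s : SymCoord k | (symMatrix s).PosDef} := by
  rw [isOpen_iff_eventually]
  intro s hs
  have hs' := (posDef_symMatrix_iff s).1 hs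
  have hc : Continuous fun p : SymCoord k × (Fin k → ℝ) => p.2 ⬝ᵥ symMatrix p.1 *ᵥ p.2 :=
    continuous_snd.dotProduct
      ((continuous_symMatrix.comp continuous_fst).matrix_mulVec continuous_snd)
  have := (isCompact_sphere (0 : Fin k → ℝ) 1).eventually_forall_of_forall_eventually
    (x₀ := s) (P := fun s v => 0 < v ⬝ᵥ symMatrix s *ᵥ v) fun v hv =>
      (hc.continuousAt (x := (s, v))).eventually_const_lt (hs' v hv)
  filter_upwards [this] with s' h'
  exact (posDef_symMatrix_iff s').2 h'

lemma measurableSet_posDef : MeasurableSet {s : SymCoord k | (symMatrix s).PosDef} :=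
  isOpen_posDef.measurableSet

lemma measurable_det_symMatrix : Measurable fun s : SymCoord k => (symMatrix s).det :=
  continuous_symMatrix.matrix_det.measurable

lemma measurable_inv_symMatrix (i j : Fin k) :
    Measurable fun s : SymCoord k => (symMatrix s)⁻¹ i j := by
  simp only [Matrix.inv_def, Ring.inverse_eq_inv', Matrix.smul_apply, smul_eq_mul]
  exact measurable_det_symMatrix.inv.mul
    (continuous_symMatrix.matrix_adjugate.matrix_elem i j).measurable

end SymMatrix

/-! ### The normal-inverse-Wishart kernel -/

section Kernel

variable {k : ℕ}

/-- The unnormalised normal-inverse-Wishart density. -/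
noncomputable def niwDensity (κ : ℝ) (m : Fin k → ℝ) (S : Matrix (Fin k) (Fin k) ℝ) (d : ℝ)
    (θ : (Fin k → ℝ) × SymCoord k) : ℝ :=
  (symMatrix θ.2).det ^ (-(d + 1) / 2) *
    Real.exp (-(κ * ((θ.1 - m) ⬝ᵥ (symMatrix θ.2)⁻¹ *ᵥ (θ.1 - m)) +
      ((symMatrix θ.2)⁻¹ * S).trace) / 2)

/-- The measure with the unnormalised normal-inverse-Wishart density. -/
noncomputable def niwMeasure (κ : ℝ) (m : Fin k → ℝ) (S : Matrix (Fin k) (Fin k) ℝ) (d : ℝ) :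
    Measure ((Fin k → ℝ) × SymCoord k) :=
  (paramMeasure k).withDensity fun θ => ENNReal.ofReal (niwDensity κ m S d θ)

/-- The set of parameters with positive definite `Σ`. -/
def posDefParams (k : ℕ) : Set ((Fin k → ℝ) × SymCoord k) := {θ | (symMatrix θ.2).PosDef}

lemma isOpen_posDefParams : IsOpen (posDefParams k) := isOpen_posDef.preimage continuous_snd

lemma measurableSet_posDefParams : MeasurableSet (posDefParams k) :=
  isOpen_posDefParams.measurableSet

lemma paramMeasure_eq : paramMeasure k = volume.restrict (posDefParams k) := rfl

lemma measurable_quadForm (m : Fin k → ℝ) : Measurable fun θ : (Fin k → ℝ) × SymCoord k =>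
    (θ.1 - m) ⬝ᵥ (symMatrix θ.2)⁻¹ *ᵥ (θ.1 - m) := by
  simp only [dotProduct, Matrix.mulVec, Pi.sub_apply]
  have h1 : ∀ i, Measurable fun θ : (Fin k → ℝ) × SymCoord k => θ.1 i - m i := fun i =>
    ((measurable_pi_apply i).comp measurable_fst).sub_const _
  have h2 : ∀ i j, Measurable fun θ : (Fin k → ℝ) × SymCoord k => (symMatrix θ.2)⁻¹ i j :=
    fun i j => (measurable_inv_symMatrix i j).comp measurable_snd
  exact Finset.measurable_fun_sum _ fun i _ => (h1 i).mul
    (Finset.measurable_fun_sum _ fun j _ => (h2 i j).mul (h1 j))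

lemma measurable_trace_inv (S : Matrix (Fin k) (Fin k) ℝ) :
    Measurable fun s : SymCoord k => ((symMatrix s)⁻¹ * S).trace := by
  simp only [Matrix.trace, Matrix.diag, Matrix.mul_apply]
  exact Finset.measurable_fun_sum _ fun i _ => Finset.measurable_fun_sum _ fun j _ =>
    (measurable_inv_symMatrix i j).mul_const _

lemma measurable_niwDensity (κ : ℝ) (m : Fin k → ℝ) (S : Matrix (Fin k) (Fin k) ℝ) (d : ℝ) :
    Measurable (niwDensity κ m S d) := by
  have h1 := measurable_quadForm m
  have h2 : Measurable fun θ : (Fin k → ℝ) × SymCoord k => ((symMatrix θ.2)⁻¹ * S).trace :=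
    (measurable_trace_inv S).comp measurable_snd
  have h3 : Measurable fun θ : (Fin k → ℝ) × SymCoord k => (symMatrix θ.2).det :=
    measurable_det_symMatrix.comp measurable_snd
  exact (h3.pow_const _).mul (((h1.const_mul κ).add h2).neg.div_const 2).exp

lemma niwDensity_pos (κ : ℝ) (m : Fin k → ℝ) (S : Matrix (Fin k) (Fin k) ℝ) (d : ℝ)
    {θ : (Fin k → ℝ) × SymCoord k} (hθ : θ ∈ posDefParams k) : 0 < niwDensity κ m S d θ :=
  mul_pos (Real.rpow_pos_of_pos (Matrix.PosDef.det_pos hθ) _) (Real.exp_pos _)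

lemma niwMeasure_eq_withDensity_indicator (κ : ℝ) (m : Fin k → ℝ) (S : Matrix (Fin k) (Fin k) ℝ)
    (d : ℝ) : niwMeasure κ m S d = volume.withDensity
      ((posDefParams k).indicator fun θ => ENNReal.ofReal (niwDensity κ m S d θ)) := by
  rw [niwMeasure, paramMeasure_eq, withDensity_indicator measurableSet_posDefParams]

/-- The density is positive on an open set containing `(0, 1)`. -/
lemma niwMeasure_univ_ne_zero (κ : ℝ) (m : Fin k → ℝ) (S : Matrix (Fin k) (Fin k) ℝ) (d : ℝ) :
    niwMeasure κ m S d Set.univ ≠ 0 := by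
  rw [niwMeasure, withDensity_apply _ MeasurableSet.univ, Measure.restrict_univ]
  have hpos : volume (posDefParams k) ≠ 0 :=
    (isOpen_posDefParams.measure_pos _ ⟨(0, symCoord 1), by
      rw [posDefParams, Set.mem_ofPred_eq, symMatrix_symCoord Matrix.transpose_one]
      exact Matrix.PosDef.one⟩).ne'
  have := (setLIntegral_pos_iff (μ := volume) (s := posDefParams k)
    (measurable_niwDensity κ m S d).ennreal_ofReal).2
  refine (this ?_).ne'
  refine lt_of_lt_of_le (pos_iff_ne_zero.2 hpos) (measure_mono fun θ hθ => ⟨?_, hθ⟩)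
  simpa using niwDensity_pos κ m S d hθ

/-- The affine action of `A` and `m` on the parameters. -/
noncomputable def paramMap (A : Matrix (Fin k) (Fin k) ℝ) (m : Fin k → ℝ)
    (θ : (Fin k → ℝ) × SymCoord k) : (Fin k → ℝ) × SymCoord k :=
  (m + A *ᵥ θ.1, symConj A θ.2)

lemma paramMap_eq (A : Matrix (Fin k) (Fin k) ℝ) (m : Fin k → ℝ) :
    paramMap A m = (fun θ => ((m, 0) : (Fin k → ℝ) × SymCoord k) + θ) ∘
      ((Matrix.toLin' A).prodMap (symConj A)) := by
  ext1 θ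
  simp [paramMap]

lemma measurable_paramMap (A : Matrix (Fin k) (Fin k) ℝ) (m : Fin k → ℝ) :
    Measurable (paramMap A m) := by
  rw [paramMap_eq]
  exact (measurable_const_add _).comp
    (LinearMap.continuous_of_finiteDimensional _).measurable

lemma map_paramMap_volume {A : Matrix (Fin k) (Fin k) ℝ} (hA : A.det ≠ 0) (m : Fin k → ℝ) :
    (volume : Measure ((Fin k → ℝ) × SymCoord k)).map (paramMap A m) =
      ENNReal.ofReal |(A.det * LinearMap.det (symConj A))⁻¹| • volume := by
  have hdet : LinearMap.det ((Matrix.toLin' A).prodMap (symConj A)) =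
      A.det * LinearMap.det (symConj A) := by
    rw [LinearMap.det_prodMap, LinearMap.det_toLin']
  have : (volume : Measure ((Fin k → ℝ) × SymCoord k)).IsAddHaarMeasure := by
    exact Measure.prod.instIsAddHaarMeasure (volume : Measure (Fin k → ℝ))
      (volume : Measure (SymCoord k))
  rw [paramMap_eq, ← Measure.map_map (measurable_const_add _)
    (LinearMap.continuous_of_finiteDimensional _).measurable,
    Measure.map_linearMap_addHaar_eq_smul_addHaar _
      (by rw [hdet]; exact mul_ne_zero hA (det_symConj_ne_zero hA)),
    Measure.map_smul, map_add_left_eq_self, hdet]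

lemma paramMap_mem_posDefParams {A : Matrix (Fin k) (Fin k) ℝ} (hA : A.det ≠ 0)
    (m : Fin k → ℝ) (θ : (Fin k → ℝ) × SymCoord k) :
    paramMap A m θ ∈ posDefParams k ↔ θ ∈ posDefParams k := by
  have hu : IsUnit A := (Matrix.isUnit_iff_isUnit_det A).2 (isUnit_iff_ne_zero.2 hA)
  simp only [posDefParams, Set.mem_ofPred_eq, paramMap, symMatrix_symConj]
  have := Matrix.IsUnit.posDef_star_right_conjugate_iff (x := symMatrix θ.2) hu
  rwa [Matrix.star_eq_conjTranspose, Matrix.conjTranspose_eq_transpose_of_trivial] at this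

lemma inv_conj {A : Matrix (Fin k) (Fin k) ℝ} (M : Matrix (Fin k) (Fin k) ℝ) :
    (A * M * Aᵀ)⁻¹ = (A⁻¹)ᵀ * M⁻¹ * A⁻¹ := by
  rw [Matrix.mul_inv_rev, Matrix.mul_inv_rev, Matrix.transpose_nonsing_inv, mul_assoc]

/-- The quadratic form and the trace are invariant when `μ`, `Σ` and `S` are transformed together;
only the determinant power changes. -/
lemma niwDensity_paramMap (κ : ℝ) (m : Fin k → ℝ) (S : Matrix (Fin k) (Fin k) ℝ) (d : ℝ)
    {A : Matrix (Fin k) (Fin k) ℝ} (hA : A.det ≠ 0) {θ : (Fin k → ℝ) × SymCoord k}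
    (hθ : θ ∈ posDefParams k) :
    niwDensity κ 0 S d θ =
      |A.det| ^ (d + 1) * niwDensity κ m (A * S * Aᵀ) d (paramMap A m θ) := by
  have hu : IsUnit A.det := isUnit_iff_ne_zero.2 hA
  have hdet : 0 < (symMatrix θ.2).det := Matrix.PosDef.det_pos hθ
  have hq : (A *ᵥ θ.1) ⬝ᵥ ((A⁻¹)ᵀ * (symMatrix θ.2)⁻¹ * A⁻¹) *ᵥ (A *ᵥ θ.1) =
      θ.1 ⬝ᵥ (symMatrix θ.2)⁻¹ *ᵥ θ.1 := by
    rw [Matrix.mulVec_mulVec, mul_assoc, Matrix.nonsing_inv_mul _ hu, mul_one,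
      ← Matrix.mulVec_mulVec, Matrix.dotProduct_mulVec, Matrix.vecMul_transpose,
      Matrix.mulVec_mulVec, Matrix.nonsing_inv_mul _ hu, Matrix.one_mulVec]
  have htr : ((A⁻¹)ᵀ * (symMatrix θ.2)⁻¹ * A⁻¹ * (A * S * Aᵀ)).trace =
      ((symMatrix θ.2)⁻¹ * S).trace := by
    rw [show (A⁻¹)ᵀ * (symMatrix θ.2)⁻¹ * A⁻¹ * (A * S * Aᵀ) =
      (A⁻¹)ᵀ * ((symMatrix θ.2)⁻¹ * (A⁻¹ * A) * S * Aᵀ) by simp only [mul_assoc],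
      Matrix.nonsing_inv_mul _ hu, mul_one, Matrix.trace_mul_comm, mul_assoc,
      ← Matrix.transpose_mul, Matrix.nonsing_inv_mul _ hu, Matrix.transpose_one, mul_one]
  simp only [niwDensity, paramMap, symMatrix_symConj, inv_conj, add_sub_cancel_left, hq, htr,
    sub_zero, Matrix.det_mul, Matrix.det_transpose]
  rw [← mul_assoc]
  congr 1
  rw [show A.det * (symMatrix θ.2).det * A.det = |A.det| ^ (2 : ℝ) * (symMatrix θ.2).det by
      rw [Real.rpow_two, sq_abs]; ring,
    Real.mul_rpow (by positivity) hdet.le, ← Real.rpow_mul (abs_nonneg _), ← mul_assoc,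
    ← Real.rpow_add (abs_pos.2 hA)]
  rw [show d + 1 + 2 * (-(d + 1) / 2) = 0 by ring, Real.rpow_zero, one_mul]

theorem map_paramMap_niwMeasure (κ : ℝ) (m : Fin k → ℝ) (S : Matrix (Fin k) (Fin k) ℝ) (d : ℝ)
    {A : Matrix (Fin k) (Fin k) ℝ} (hA : A.det ≠ 0) :
    (niwMeasure κ 0 S d).map (paramMap A m) =
      ENNReal.ofReal (|A.det| ^ (d + 1) * |(A.det * LinearMap.det (symConj A))⁻¹|) •
        niwMeasure κ m (A * S * Aᵀ) d := by
  have hmeas := (measurable_niwDensity κ m (A * S * Aᵀ) d).ennreal_ofReal.indicator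
    measurableSet_posDefParams
  ext s hs
  have hmeas' : Measurable fun θ => s.indicator ((posDefParams k).indicator
      fun θ => ENNReal.ofReal (niwDensity κ m (A * S * Aᵀ) d θ)) (paramMap A m θ) :=
    (hmeas.indicator hs).comp (measurable_paramMap A m)
  rw [Measure.map_apply (measurable_paramMap A m) hs, Measure.smul_apply,
    niwMeasure_eq_withDensity_indicator, niwMeasure_eq_withDensity_indicator,
    withDensity_apply _ hs, withDensity_apply _ (measurable_paramMap A m hs),
    ← lintegral_indicator hs, ← lintegral_indicator (measurable_paramMap A m hs)]
  have h1 : ∀ θ, ((paramMap A m ⁻¹' s).indicator ((posDefParams k).indicator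
      fun θ => ENNReal.ofReal (niwDensity κ 0 S d θ))) θ =
      ENNReal.ofReal (|A.det| ^ (d + 1)) * (s.indicator ((posDefParams k).indicator
        fun θ => ENNReal.ofReal (niwDensity κ m (A * S * Aᵀ) d θ))) (paramMap A m θ) := by
    intro θ
    by_cases hθs : paramMap A m θ ∈ s
    · by_cases hθ : θ ∈ posDefParams k
      · rw [Set.indicator_of_mem (show θ ∈ paramMap A m ⁻¹' s from hθs),
          Set.indicator_of_mem hθ, Set.indicator_of_mem hθs,
          Set.indicator_of_mem ((paramMap_mem_posDefParams hA m θ).2 hθ),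
          ← ENNReal.ofReal_mul (by positivity), ← niwDensity_paramMap κ m S d hA hθ]
      · rw [Set.indicator_of_mem (show θ ∈ paramMap A m ⁻¹' s from hθs),
          Set.indicator_of_notMem hθ, Set.indicator_of_mem hθs,
          Set.indicator_of_notMem (fun h => hθ ((paramMap_mem_posDefParams hA m θ).1 h)),
          mul_zero]
    · rw [Set.indicator_of_notMem (show θ ∉ paramMap A m ⁻¹' s from hθs),
        Set.indicator_of_notMem hθs, mul_zero]
  simp only [h1]
  rw [lintegral_const_mul _ hmeas',
    ← lintegral_map (hmeas.indicator hs) (measurable_paramMap A m), map_paramMap_volume hA,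
    lintegral_smul_measure, smul_eq_mul, smul_eq_mul, ENNReal.ofReal_mul (by positivity),
    mul_assoc (ENNReal.ofReal _)]

/-- Apply the change of variables with `A = √t • 1`. The exponent is `k (d + 1) / 2` from the
density, minus `k / 2` and `k (k + 1) / 2` from the Jacobians in `μ` and `Σ`. -/
lemma niwMeasure_smul_one (κ d : ℝ) {t : ℝ} (ht : 0 < t) :
    niwMeasure κ (0 : Fin k → ℝ) 1 d Set.univ =
      ENNReal.ofReal (t ^ ((k : ℝ) * (d - k - 1) / 2)) *
        niwMeasure κ (0 : Fin k → ℝ) (t • 1) d Set.univ := by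
  have hdet : (Real.sqrt t • (1 : Matrix (Fin k) (Fin k) ℝ)).det = t ^ ((k : ℝ) / 2) := by
    rw [Matrix.det_smul, Matrix.det_one, mul_one, Fintype.card_fin, Real.sqrt_eq_rpow,
      ← Real.rpow_natCast, ← Real.rpow_mul ht.le]
    congr 1; ring
  have hA : (Real.sqrt t • (1 : Matrix (Fin k) (Fin k) ℝ)).det ≠ 0 := by
    rw [hdet]; positivity
  have h := congrArg (fun ν => ν Set.univ) (map_paramMap_niwMeasure κ 0 1 d hA)
  simp only [Measure.smul_apply, smul_eq_mul] at h
  rw [Measure.map_apply (measurable_paramMap _ _) MeasurableSet.univ, Set.preimage_univ,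
    det_symConj_smul_one ht, hdet] at h
  rw [h]
  congr 2
  · rw [abs_of_pos (by positivity), abs_of_pos (by positivity), ← Real.rpow_mul ht.le,
      ← Real.rpow_add ht, ← Real.rpow_neg ht.le, ← Real.rpow_add ht]
    congr 1; ring
  · rw [mul_one, Matrix.transpose_smul, Matrix.transpose_one, smul_mul_smul_comm, mul_one,
      Real.mul_self_sqrt ht.le]

end Kernel

/-! ### Gaussian integrals -/

section Gaussian

variable {k : ℕ}

open scoped MatrixOrder Matrix.Norms.L2Operator in
lemma exists_eq_mul_transpose {P : Matrix (Fin k) (Fin k) ℝ} (hP : P.PosDef) :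
    ∃ A : Matrix (Fin k) (Fin k) ℝ, A.det ≠ 0 ∧ P = A * Aᵀ := by
  obtain ⟨B, hB⟩ := CStarAlgebra.nonneg_iff_eq_star_mul_self.mp hP.posSemidef.nonneg
  rw [Matrix.star_eq_conjTranspose, Matrix.conjTranspose_eq_transpose_of_trivial] at hB
  refine ⟨Bᵀ, fun h => hP.det_pos.ne' ?_, by rw [Matrix.transpose_transpose, hB]⟩
  rw [hB, Matrix.det_mul, h, zero_mul]

lemma lintegral_comp_mulVec {M : Matrix (Fin k) (Fin k) ℝ} (hM : M.det ≠ 0)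
    {f : (Fin k → ℝ) → ENNReal} (hf : Measurable f) :
    ∫⁻ v, f (M *ᵥ v) = ENNReal.ofReal |M.det⁻¹| * ∫⁻ v, f v := by
  have hmeas : Measurable (Matrix.toLin' M) :=
    (LinearMap.continuous_of_finiteDimensional _).measurable
  rw [← smul_eq_mul, ← lintegral_smul_measure, ← Real.map_matrix_volume_pi_eq_smul_volume_pi hM,
    lintegral_map hf hmeas]
  rfl

/-- The Gaussian integral over `ℝᵏ`. -/
noncomputable def stdGaussianMass (k : ℕ) : ENNReal :=
  ∫⁻ v : Fin k → ℝ, ENNReal.ofReal (Real.exp (-(v ⬝ᵥ v) / 2))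

lemma measurable_exp_neg_dotProduct :
    Measurable fun v : Fin k → ℝ => ENNReal.ofReal (Real.exp (-(v ⬝ᵥ v) / 2)) := by
  simp only [dotProduct]
  fun_prop

lemma stdGaussianMass_lt_top (k : ℕ) : stdGaussianMass k < ⊤ := by
  have h1 : Integrable fun x : ℝ => Real.exp (-(1 / 2) * x ^ 2) :=
    integrable_exp_neg_mul_sq (by norm_num)
  have h2 : Integrable fun v : Fin k → ℝ => ∏ i, Real.exp (-(1 / 2) * v i ^ 2) :=
    Integrable.fintype_prod fun _ => h1
  refine lt_of_le_of_lt (le_of_eq ?_) h2.lintegral_lt_top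
  refine lintegral_congr fun v => ?_
  rw [← Real.exp_sum]
  congr 2
  rw [dotProduct, neg_div, Finset.sum_div, ← Finset.sum_neg_distrib]
  exact Finset.sum_congr rfl fun i _ => by ring

/-- Write `P = B Bᵀ` and substitute `Bᵀ v`. The standard Gaussian mass stays unevaluated, because
only its finiteness is used. -/
lemma lintegral_exp_neg_quadForm {P : Matrix (Fin k) (Fin k) ℝ} (hP : P.PosDef) :
    ∫⁻ v : Fin k → ℝ, ENNReal.ofReal (Real.exp (-(v ⬝ᵥ P *ᵥ v) / 2)) =
      ENNReal.ofReal (P.det ^ (-(1 : ℝ) / 2)) * stdGaussianMass k := by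
  obtain ⟨B, hB0, hB⟩ := exists_eq_mul_transpose hP
  have hdet : P.det = |Bᵀ.det| ^ (2 : ℝ) := by
    rw [hB, Matrix.det_mul, Matrix.det_transpose, Real.rpow_two, sq_abs, sq]
  rw [← Matrix.det_transpose] at hB0
  rw [stdGaussianMass, hdet, ← Real.rpow_mul (abs_nonneg _),
    show (2 : ℝ) * (-1 / 2) = -1 by norm_num, Real.rpow_neg_one, ← abs_inv,
    ← lintegral_comp_mulVec hB0 measurable_exp_neg_dotProduct]
  refine lintegral_congr fun v => ?_
  rw [hB, ← Matrix.mulVec_mulVec, Matrix.dotProduct_mulVec, ← Matrix.mulVec_transpose]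

end Gaussian

/-! ### Bordered matrices -/

section Bordered

variable {k : ℕ}

/-- The matrix with rows `(a, b)` and `(b, S)`. -/
def bordered (a : ℝ) (b : Fin k → ℝ) (S : Matrix (Fin k) (Fin k) ℝ) :
    Matrix (Fin (k + 1)) (Fin (k + 1)) ℝ :=
  Matrix.of fun i j => Fin.cases (Fin.cases a b j) (fun i' => Fin.cases (b i') (S i') j) i

@[simp] lemma bordered_zero_zero (a : ℝ) (b : Fin k → ℝ) (S : Matrix (Fin k) (Fin k) ℝ) :
    bordered a b S 0 0 = a := rfl

@[simp] lemma bordered_zero_succ (a : ℝ) (b : Fin k → ℝ) (S : Matrix (Fin k) (Fin k) ℝ)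
    (j : Fin k) : bordered a b S 0 j.succ = b j := rfl

@[simp] lemma bordered_succ_zero (a : ℝ) (b : Fin k → ℝ) (S : Matrix (Fin k) (Fin k) ℝ)
    (i : Fin k) : bordered a b S i.succ 0 = b i := rfl

@[simp] lemma bordered_succ_succ (a : ℝ) (b : Fin k → ℝ) (S : Matrix (Fin k) (Fin k) ℝ)
    (i j : Fin k) : bordered a b S i.succ j.succ = S i j := rfl

lemma bordered_transpose (a : ℝ) (b : Fin k → ℝ) (S : Matrix (Fin k) (Fin k) ℝ) :
    (bordered a b S)ᵀ = bordered a b Sᵀ := by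
  ext i j
  refine Fin.cases (Fin.cases ?_ (fun j => ?_) j)
    (fun i => Fin.cases ?_ (fun j => ?_) j) i <;> simp

lemma bordered_add (a a' : ℝ) (b b' : Fin k → ℝ) (S S' : Matrix (Fin k) (Fin k) ℝ) :
    bordered (a + a') (b + b') (S + S') = bordered a b S + bordered a' b' S' := by
  ext i j
  refine Fin.cases (Fin.cases ?_ (fun j => ?_) j)
    (fun i => Fin.cases ?_ (fun j => ?_) j) i <;> simp

lemma bordered_smul (c a : ℝ) (b : Fin k → ℝ) (S : Matrix (Fin k) (Fin k) ℝ) :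
    bordered (c • a) (c • b) (c • S) = c • bordered a b S := by
  ext i j
  refine Fin.cases (Fin.cases ?_ (fun j => ?_) j)
    (fun i => Fin.cases ?_ (fun j => ?_) j) i <;> simp

/-- The determinant of a bordered matrix, in terms of the Schur complement `q`. -/
lemma det_bordered {S : Matrix (Fin k) (Fin k) ℝ} (hST : Sᵀ = S) (q : ℝ) (β : Fin k → ℝ) :
    (bordered (q + β ⬝ᵥ S *ᵥ β) (S *ᵥ β) S).det = q * S.det := by
  -- Block factorisation `U * L` with `U` unipotent upper triangular and `L` block lower triangular
  -- with diagonal blocks `q` and `S`.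
  let L : Matrix (Fin (k + 1)) (Fin (k + 1)) ℝ :=
    Matrix.of fun i j => Fin.cases (Fin.cases q 0 j) (fun i' => Fin.cases ((S *ᵥ β) i') (S i') j) i
  let U : Matrix (Fin (k + 1)) (Fin (k + 1)) ℝ :=
    Matrix.of fun i j => Fin.cases (Fin.cases 1 β j)
      (fun i' => Fin.cases 0 ((1 : Matrix (Fin k) (Fin k) ℝ) i') j) i
  have hL : L.det = q * S.det := by
    have h1 : L.submatrix Fin.succ Fin.succ = S := rfl
    have h2 : ∀ j : Fin k, L 0 j.succ = 0 := fun _ => rfl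
    have h3 : L 0 0 = q := rfl
    rw [Matrix.det_succ_row_zero, Fin.sum_univ_succ]
    simp [h1, h2, h3]
  have hU : U.det = 1 := by
    have h1 : U.submatrix Fin.succ Fin.succ = 1 := rfl
    have h2 : ∀ j : Fin k, U j.succ 0 = 0 := fun _ => rfl
    have h3 : U 0 0 = 1 := rfl
    rw [Matrix.det_succ_column_zero, Fin.sum_univ_succ]
    simp [h1, h2, h3]
  have hUL : U * L = bordered (q + β ⬝ᵥ S *ᵥ β) (S *ᵥ β) S := by
    ext i j
    rw [Matrix.mul_apply, Fin.sum_univ_succ]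
    refine Fin.cases (Fin.cases ?_ (fun j => ?_) j) (fun i => Fin.cases ?_ (fun j => ?_) j) i
    · simp [U, L, dotProduct]
    · have := congrFun (Matrix.mulVec_transpose S β) j
      rw [hST] at this
      simp [U, L, this, Matrix.vecMul, dotProduct]
    · simp [U, L, Matrix.one_apply]
    · simp [U, L, Matrix.one_apply]
  rw [← hUL, Matrix.det_mul, hU, hL, one_mul]

/-- Block inversion: `q` is the Schur complement of `S`, and `β` the regression coefficients `S⁻¹ b`
of the border `b = S β`. The product is checked block by block. -/
lemma inv_bordered {S : Matrix (Fin k) (Fin k) ℝ} (hS : S.det ≠ 0) (hST : Sᵀ = S) {q : ℝ}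
    (hq : q ≠ 0) (β : Fin k → ℝ) :
    (bordered (q + β ⬝ᵥ S *ᵥ β) (S *ᵥ β) S)⁻¹ =
      bordered q⁻¹ (-q⁻¹ • β) (S⁻¹ + q⁻¹ • Matrix.vecMulVec β β) := by
  have hSS : S * S⁻¹ = 1 := Matrix.mul_nonsing_inv _ (isUnit_iff_ne_zero.2 hS)
  have hβ : (S *ᵥ β) ᵥ* S⁻¹ = β := by
    rw [← hST, Matrix.mulVec_transpose, Matrix.vecMul_vecMul, hST, hSS, Matrix.vecMul_one]
  have hc : S *ᵥ β ⬝ᵥ β = β ⬝ᵥ S *ᵥ β := dotProduct_comm _ _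
  refine Matrix.inv_eq_right_inv ?_
  ext i j
  rw [Matrix.mul_apply, Fin.sum_univ_succ]
  refine Fin.cases (Fin.cases ?_ (fun j => ?_) j) (fun i => Fin.cases ?_ (fun j => ?_) j) i
  · have : ∑ x, (S *ᵥ β) x * (-q⁻¹ • β) x = -q⁻¹ * (β ⬝ᵥ S *ᵥ β) := by
      rw [← hc]
      simp only [dotProduct, Finset.mul_sum, Pi.smul_apply, smul_eq_mul]
      exact Finset.sum_congr rfl fun x _ => by ring
    simp only [bordered_zero_zero, bordered_zero_succ, bordered_succ_zero, this,
      Matrix.one_apply_eq]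
    field_simp
    ring
  · have : ∑ x, (S *ᵥ β) x * (S⁻¹ + q⁻¹ • Matrix.vecMulVec β β) x j =
        β j + q⁻¹ * (β ⬝ᵥ S *ᵥ β) * β j := by
      have h := congrFun hβ j
      rw [← hc]
      conv_rhs => enter [1]; rw [← h]
      simp only [dotProduct, Matrix.vecMul, Matrix.add_apply, mul_add, Finset.sum_add_distrib,
        Matrix.smul_apply, Matrix.vecMulVec_apply, smul_eq_mul, Finset.mul_sum, Finset.sum_mul]
      congr 1
      exact Finset.sum_congr rfl fun x _ => by ring
    simp only [bordered_zero_zero, bordered_zero_succ, bordered_succ_succ, this]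
    rw [Matrix.one_apply_ne (Fin.succ_ne_zero j).symm]
    simp only [Pi.smul_apply, smul_eq_mul]
    field_simp
    ring
  · have : ∑ x, S i x * (-q⁻¹ • β) x = -q⁻¹ * (S *ᵥ β) i := by
      simp only [Matrix.mulVec, dotProduct, Finset.mul_sum, Pi.smul_apply, smul_eq_mul]
      exact Finset.sum_congr rfl fun x _ => by ring
    simp only [bordered_zero_zero, bordered_succ_zero, bordered_succ_succ, this]
    rw [Matrix.one_apply_ne (Fin.succ_ne_zero i)]
    ring
  · have : ∑ x, S i x * (S⁻¹ + q⁻¹ • Matrix.vecMulVec β β) x j =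
        (1 : Matrix (Fin k) (Fin k) ℝ) i j + q⁻¹ * (S *ᵥ β) i * β j := by
      rw [← hSS, Matrix.mul_apply]
      simp only [Matrix.mulVec, dotProduct, Matrix.add_apply, mul_add, Finset.sum_add_distrib,
        Matrix.smul_apply, Matrix.vecMulVec_apply, smul_eq_mul, Finset.mul_sum, Finset.sum_mul]
      congr 1
      exact Finset.sum_congr rfl fun x _ => by ring
    simp only [bordered_zero_succ, bordered_succ_zero, bordered_succ_succ, this, Pi.smul_apply,
      smul_eq_mul]
    rw [Matrix.one_apply, Matrix.one_apply]
    simp only [Fin.succ_inj]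
    ring

lemma trace_inv_bordered {S : Matrix (Fin k) (Fin k) ℝ} (hS : S.det ≠ 0) (hST : Sᵀ = S) {q : ℝ}
    (hq : q ≠ 0) (β : Fin k → ℝ) :
    (bordered (q + β ⬝ᵥ S *ᵥ β) (S *ᵥ β) S)⁻¹.trace = (S⁻¹).trace + (1 + β ⬝ᵥ β) / q := by
  rw [inv_bordered hS hST hq, Matrix.trace, Fin.sum_univ_succ]
  simp only [Matrix.diag, bordered_zero_zero, bordered_succ_succ, Matrix.add_apply,
    Finset.sum_add_distrib, Matrix.smul_apply, Matrix.vecMulVec_apply, smul_eq_mul, Matrix.trace,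
    dotProduct, ← Finset.mul_sum]
  ring

/-- Coordinates on symmetric matrices of size `k + 1` through bordered matrices. -/
def borderedEquiv (k : ℕ) : (SymCoord k × ((Fin k → ℝ) × ℝ)) ≃ₗ[ℝ] SymCoord (k + 1) where
  toFun p := symCoord (bordered p.2.2 p.2.1 (symMatrix p.1))
  invFun t := (fun p => t ⟨(p.1.1.succ, p.1.2.succ), Fin.succ_le_succ_iff.2 p.2⟩,
    (fun i => t ⟨(0, i.succ), Fin.zero_le _⟩, t ⟨(0, 0), le_rfl⟩))
  map_add' p p' := congrArg symCoord (bordered_add p.2.2 p'.2.2 p.2.1 p'.2.1 _ _)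
  map_smul' c p := congrArg symCoord (bordered_smul c p.2.2 p.2.1 (symMatrix p.1))
  left_inv p := by
    refine Prod.ext ?_ rfl
    exact symCoord_symMatrix p.1
  right_inv t := by
    ext ⟨⟨i, j⟩, h⟩
    revert h
    refine Fin.cases (Fin.cases ?_ (fun j => ?_) j)
      (fun i => Fin.cases ?_ (fun j => ?_) j) i
    · intro h; rfl
    · intro h; rfl
    · intro h
      exact absurd h (by simp)
    · intro h
      have h' : i ≤ j := Fin.succ_le_succ_iff.1 h
      simp [symCoord, symMatrix_apply, h']

lemma symMatrix_borderedEquiv (p : SymCoord k × ((Fin k → ℝ) × ℝ)) :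
    symMatrix (borderedEquiv k p) = bordered p.2.2 p.2.1 (symMatrix p.1) :=
  symMatrix_symCoord (M := bordered p.2.2 p.2.1 (symMatrix p.1))
    (by rw [bordered_transpose, symMatrix_transpose])

/-- Lebesgue measure and the image of the product measure are both Haar, hence proportional. The
constant is immaterial for finiteness. -/
lemma exists_lintegral_symCoord_succ (k : ℕ) : ∃ c : NNReal,
    ∀ f : SymCoord (k + 1) → ENNReal, Measurable f →
      ∫⁻ s, f s = c * ∫⁻ s, ∫⁻ b, ∫⁻ a, f (borderedEquiv k (s, b, a)) := by
  have h1 : (volume : Measure ((Fin k → ℝ) × ℝ)).IsAddHaarMeasure :=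
    Measure.prod.instIsAddHaarMeasure (volume : Measure (Fin k → ℝ)) (volume : Measure ℝ)
  have h2 : (volume : Measure (SymCoord k × ((Fin k → ℝ) × ℝ))).IsAddHaarMeasure :=
    Measure.prod.instIsAddHaarMeasure (volume : Measure (SymCoord k)) _
  have hcont : Continuous (borderedEquiv k) :=
    LinearMap.continuous_of_finiteDimensional (borderedEquiv k).toLinearMap
  have h3 := (borderedEquiv k).toContinuousLinearEquiv.isAddHaarMeasure_map
    (volume : Measure (SymCoord k × ((Fin k → ℝ) × ℝ)))
  rw [LinearEquiv.coe_toContinuousLinearEquiv'] at h3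
  obtain ⟨c, hc⟩ : ∃ c : NNReal, (volume : Measure (SymCoord (k + 1))) =
      c • (volume : Measure (SymCoord k × ((Fin k → ℝ) × ℝ))).map (borderedEquiv k) :=
    ⟨_, Measure.isAddLeftInvariant_eq_smul _ _⟩
  refine ⟨c, fun f hf => ?_⟩
  have hm : Measurable fun p => f (borderedEquiv k p) := hf.comp hcont.measurable
  rw [hc, lintegral_smul_measure, lintegral_map hf hcont.measurable, Measure.volume_eq_prod,
    lintegral_prod _ hm.aemeasurable]
  rw [ENNReal.smul_def, smul_eq_mul]
  congr 1
  refine lintegral_congr fun s => ?_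
  have hm' : Measurable fun p => f (borderedEquiv k (s, p)) := hm.comp measurable_prodMk_left
  rw [Measure.volume_eq_prod, lintegral_prod _ hm'.aemeasurable]

end Bordered

/-! ### Finiteness of the normal-inverse-Wishart measure -/

section Finiteness

variable {k : ℕ}

/-- The inverse Wishart kernel with scale matrix `1`, extended by zero. -/
noncomputable def iwKernel (k : ℕ) (d : ℝ) : SymCoord k → ENNReal :=
  {s | (symMatrix s).PosDef}.indicator fun s =>
    ENNReal.ofReal ((symMatrix s).det ^ (-d / 2) * Real.exp (-((symMatrix s)⁻¹).trace / 2))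

lemma measurable_iwKernel (d : ℝ) : Measurable (iwKernel k d) := by
  have h := measurable_trace_inv (k := k) 1
  simp only [mul_one] at h
  exact ((measurable_det_symMatrix.pow_const _).mul
    (h.neg.div_const 2).exp).ennreal_ofReal.indicator measurableSet_posDef

/-- Near zero the exponential beats the power: bound `exp (1 / (2q))` below by the term of order
`⌈a⌉₊` of its series. -/
lemma rpow_neg_mul_exp_le {a q : ℝ} (hq : 0 < q) (hq1 : q ≤ 1) :
    q ^ (-a) * Real.exp (-(1 / q) / 2) ≤ 2 ^ ⌈a⌉₊ * (⌈a⌉₊).factorial := by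
  set n := ⌈a⌉₊
  have hu : 1 ≤ 1 / q := by rw [le_div_iff₀ hq]; linarith
  have h1 : q ^ (-a) ≤ (1 / q) ^ n := by
    rw [Real.rpow_neg hq.le, ← Real.inv_rpow hq.le, ← one_div, ← Real.rpow_natCast]
    exact Real.rpow_le_rpow_of_exponent_le hu (Nat.le_ceil a)
  have h2 := Real.pow_div_factorial_le_exp (1 / q / 2) (by positivity) n
  have hf : (0 : ℝ) < n.factorial := by exact_mod_cast n.factorial_pos
  rw [div_le_iff₀ hf, div_pow, div_le_iff₀ (by positivity)] at h2
  calc q ^ (-a) * Real.exp (-(1 / q) / 2)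
      ≤ (Real.exp (1 / q / 2) * n.factorial * 2 ^ n) * Real.exp (-(1 / q) / 2) :=
        mul_le_mul_of_nonneg_right (h1.trans h2) (Real.exp_pos _).le
    _ = 2 ^ n * n.factorial * (Real.exp (1 / q / 2) * Real.exp (-(1 / q) / 2)) := by ring
    _ = 2 ^ n * n.factorial := by
        rw [← Real.exp_add, show 1 / q / 2 + -(1 / q) / 2 = 0 by ring, Real.exp_zero, mul_one]

lemma lintegral_rpow_neg_mul_exp_lt_top {a : ℝ} (ha : 1 < a) :
    ∫⁻ q in Set.Ioi (0 : ℝ), ENNReal.ofReal (q ^ (-a) * Real.exp (-(1 / q) / 2)) < ⊤ := by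
  rw [← Set.Ioc_union_Ioi_eq_Ioi (zero_le_one : (0 : ℝ) ≤ 1)]
  refine lt_of_le_of_lt (lintegral_union_le _ _ _) (ENNReal.add_lt_top.2 ⟨?_, ?_⟩)
  · refine lt_of_le_of_lt (setLIntegral_mono measurable_const fun q hq =>
      ENNReal.ofReal_le_ofReal (rpow_neg_mul_exp_le hq.1 hq.2)) ?_
    rw [setLIntegral_const, Real.volume_Ioc]
    exact ENNReal.mul_lt_top ENNReal.ofReal_lt_top ENNReal.ofReal_lt_top
  · have hint : IntegrableOn (fun q : ℝ => q ^ (-a)) (Set.Ioi 1) :=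
      integrableOn_Ioi_rpow_of_lt (by linarith) one_pos
    refine lt_of_le_of_lt (setLIntegral_mono' measurableSet_Ioi fun q hq =>
      ENNReal.ofReal_le_ofReal ?_) hint.lintegral_lt_top
    have hq0 : (0 : ℝ) < q := one_pos.trans hq
    refine mul_le_of_le_one_right (by positivity) (Real.exp_le_one_iff.2 ?_)
    have : 0 < 1 / q := by positivity
    linarith

/-- The kernel of the Schur complement and the regression coefficients. -/
noncomputable def schurKernel (k : ℕ) (d : ℝ) (β : Fin k → ℝ) (q : ℝ) : ENNReal :=
  (Set.Ioi 0).indicator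
    (fun q => ENNReal.ofReal (q ^ (-d / 2) * Real.exp (-((1 + β ⬝ᵥ β) / q) / 2))) q

lemma measurable_schurKernel (d : ℝ) : Measurable fun p : (Fin k → ℝ) × ℝ =>
    schurKernel k d p.1 p.2 := by
  have h : Measurable fun p : (Fin k → ℝ) × ℝ =>
      ENNReal.ofReal (p.2 ^ (-d / 2) * Real.exp (-((1 + p.1 ⬝ᵥ p.1) / p.2) / 2)) := by
    simp only [dotProduct]
    fun_prop
  exact h.indicator (measurable_snd measurableSet_Ioi)

/-- By Tonelli, integrate `β` first: a Gaussian integral with covariance `q • 1` contributes `q ^ (k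
/ 2)`. What remains is `q ^ (-(d - k) / 2) * exp (-1 / (2q))`, integrable at infinity since `(d - k)
/ 2 > 1`. -/
lemma lintegral_schurKernel_lt_top {d : ℝ} (hd : (k : ℝ) + 2 < d) :
    ∫⁻ β, ∫⁻ q, schurKernel k d β q < ⊤ := by
  have hswap : ∫⁻ β, ∫⁻ q, schurKernel k d β q = ∫⁻ q, ∫⁻ β, schurKernel k d β q :=
    lintegral_lintegral_swap (measurable_schurKernel d).aemeasurable
  have hin : ∀ q, ∫⁻ β, schurKernel k d β q = (Set.Ioi 0).indicator (fun q =>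
      ENNReal.ofReal (q ^ (-((d - k) / 2)) * Real.exp (-(1 / q) / 2)) * stdGaussianMass k) q := by
    intro q
    by_cases hq : q ∈ Set.Ioi (0 : ℝ)
    · have hq0 : 0 < q := hq
      have hP : (q⁻¹ • (1 : Matrix (Fin k) (Fin k) ℝ)).PosDef :=
        Matrix.PosDef.one.smul (by positivity)
      have hG := lintegral_exp_neg_quadForm hP
      rw [Matrix.det_smul, Matrix.det_one, mul_one, Fintype.card_fin, ← Real.rpow_natCast,
        Real.inv_rpow hq0.le, ← Real.rpow_neg hq0.le, ← Real.rpow_mul hq0.le] at hG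
      simp only [schurKernel, Set.indicator_of_mem hq]
      have hfac : ∀ β : Fin k → ℝ,
          ENNReal.ofReal (q ^ (-d / 2) * Real.exp (-((1 + β ⬝ᵥ β) / q) / 2)) =
          ENNReal.ofReal (q ^ (-d / 2) * Real.exp (-(1 / q) / 2)) *
            ENNReal.ofReal (Real.exp
              (-(β ⬝ᵥ (q⁻¹ • (1 : Matrix (Fin k) (Fin k) ℝ)) *ᵥ β) / 2)) := by
        intro β
        rw [← ENNReal.ofReal_mul (by positivity), mul_assoc, ← Real.exp_add,
          Matrix.smul_mulVec, Matrix.one_mulVec, dotProduct_smul, smul_eq_mul]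
        congr 3
        field_simp
        ring
      simp only [hfac]
      rw [lintegral_const_mul', hG, ← mul_assoc, ← ENNReal.ofReal_mul (by positivity)]
      · congr 2
        rw [mul_right_comm, ← Real.rpow_add hq0]
        congr 2
        ring
      · exact ENNReal.ofReal_ne_top
    · simp [schurKernel, Set.indicator_of_notMem hq]
  rw [hswap]
  simp only [hin]
  rw [lintegral_indicator measurableSet_Ioi, lintegral_mul_const' _ _ (stdGaussianMass_lt_top k).ne]
  exact ENNReal.mul_lt_top (lintegral_rpow_neg_mul_exp_lt_top (by linarith))
    (stdGaussianMass_lt_top k)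

lemma posDef_of_bordered {a : ℝ} {b : Fin k → ℝ} {S : Matrix (Fin k) (Fin k) ℝ}
    (h : (bordered a b S).PosDef) : S.PosDef :=
  h.submatrix (e := Fin.succ) (Fin.succ_injective k)

/-- In the coordinates `(β, q)` the determinant factors and the trace of the inverse splits, so the
kernel factors. Positive definiteness forces `q > 0`; an inequality suffices, so the converse is not
needed. -/
lemma iwKernel_bordered_le (d : ℝ) {s : SymCoord k} (hs : (symMatrix s).PosDef)
    (β : Fin k → ℝ) (q : ℝ) :
    iwKernel (k + 1) d (borderedEquiv k
      (s, symMatrix s *ᵥ β, q + β ⬝ᵥ symMatrix s *ᵥ β)) ≤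
      iwKernel k d s * schurKernel k d β q := by
  set t := borderedEquiv k (s, symMatrix s *ᵥ β, q + β ⬝ᵥ symMatrix s *ᵥ β) with ht
  have htM : symMatrix t =
      bordered (q + β ⬝ᵥ symMatrix s *ᵥ β) (symMatrix s *ᵥ β) (symMatrix s) := by
    rw [ht, symMatrix_borderedEquiv]
  have hdet : (symMatrix t).det = q * (symMatrix s).det := by
    rw [htM, det_bordered (symMatrix_transpose s)]
  by_cases hPD : (symMatrix t).PosDef
  · have hdpos := hPD.det_pos
    rw [hdet] at hdpos
    have hq : 0 < q := (pos_iff_pos_of_mul_pos hdpos).2 hs.det_pos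
    have htr : (symMatrix t)⁻¹.trace = ((symMatrix s)⁻¹).trace + (1 + β ⬝ᵥ β) / q := by
      rw [htM, trace_inv_bordered hs.det_pos.ne' (symMatrix_transpose s) hq.ne']
    rw [iwKernel, Set.indicator_of_mem (show t ∈ {s | (symMatrix s).PosDef} from hPD), iwKernel,
      Set.indicator_of_mem (show s ∈ {s | (symMatrix s).PosDef} from hs), schurKernel,
      Set.indicator_of_mem (show q ∈ Set.Ioi 0 from hq), hdet, htr, ← ENNReal.ofReal_mul
        (mul_nonneg (Real.rpow_nonneg hs.det_pos.le _) (Real.exp_pos _).le),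
      Real.mul_rpow hq.le hs.det_pos.le, neg_add, add_div, Real.exp_add]
    apply le_of_eq
    congr 1
    ring
  · rw [iwKernel, Set.indicator_of_notMem (show t ∉ {s | (symMatrix s).PosDef} from hPD)]
    exact zero_le

/-- The substitution `b = S β` has Jacobian `det S`, which lowers the index of the `k`-dimensional
kernel from `d` to `d - 2`. -/
lemma lintegral_iwKernel_succ_le (k : ℕ) (d : ℝ) : ∃ c : NNReal,
    ∫⁻ s, iwKernel (k + 1) d s ≤
      c * ((∫⁻ s, iwKernel k (d - 2) s) * ∫⁻ β, ∫⁻ q, schurKernel k d β q) := by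
  obtain ⟨c, hc⟩ := exists_lintegral_symCoord_succ k
  refine ⟨c, ?_⟩
  rw [hc _ (measurable_iwKernel d)]
  refine mul_le_mul_right ?_ _
  rw [← lintegral_mul_const _ (measurable_iwKernel _)]
  refine lintegral_mono fun s => ?_
  have hm : Measurable fun p : (Fin k → ℝ) × ℝ =>
      iwKernel (k + 1) d (borderedEquiv k (s, p.1, p.2)) := by
    refine (measurable_iwKernel d).comp ?_
    have hcont : Continuous (borderedEquiv k) :=
      LinearMap.continuous_of_finiteDimensional (borderedEquiv k).toLinearMap
    exact hcont.measurable.comp measurable_prodMk_left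
  by_cases hs : (symMatrix s).PosDef
  · have hd0 := hs.det_pos
    have hm' : Measurable fun b => ∫⁻ a, iwKernel (k + 1) d (borderedEquiv k (s, b, a)) :=
      hm.lintegral_prod_right'
    have hsub := lintegral_comp_mulVec hd0.ne' hm'
    have hsub' : ∫⁻ b, ∫⁻ a, iwKernel (k + 1) d (borderedEquiv k (s, b, a)) =
        ENNReal.ofReal (symMatrix s).det * ∫⁻ β, ∫⁻ a, iwKernel (k + 1) d
          (borderedEquiv k (s, symMatrix s *ᵥ β, a)) := by
      rw [hsub, ← mul_assoc, ← ENNReal.ofReal_mul hd0.le, abs_of_pos (inv_pos.2 hd0),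
        mul_inv_cancel₀ hd0.ne', ENNReal.ofReal_one, one_mul]
    have hker : iwKernel k (d - 2) s = ENNReal.ofReal (symMatrix s).det * iwKernel k d s := by
      rw [iwKernel, iwKernel, Set.indicator_of_mem (show s ∈ {s | (symMatrix s).PosDef} from hs),
        Set.indicator_of_mem (show s ∈ {s | (symMatrix s).PosDef} from hs),
        ← ENNReal.ofReal_mul hd0.le, ← mul_assoc, show -(d - 2) / 2 = 1 + -d / 2 by ring,
        Real.rpow_add hd0, Real.rpow_one]
    rw [hsub', hker, mul_assoc]
    refine mul_le_mul_right ?_ _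
    rw [← lintegral_const_mul' _ _ (by
      rw [iwKernel, Set.indicator_of_mem (show s ∈ {s | (symMatrix s).PosDef} from hs)]
      exact ENNReal.ofReal_ne_top)]
    refine lintegral_mono fun β => ?_
    -- Translation passes from the corner entry `a` to the Schur complement `q`.
    rw [← lintegral_add_right_eq_self _ (β ⬝ᵥ symMatrix s *ᵥ β), ← lintegral_const_mul' _ _ (by
      rw [iwKernel, Set.indicator_of_mem (show s ∈ {s | (symMatrix s).PosDef} from hs)]
      exact ENNReal.ofReal_ne_top)]
    exact lintegral_mono fun q => iwKernel_bordered_le d hs β q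
  · have h0 : ∀ b a, iwKernel (k + 1) d (borderedEquiv k (s, b, a)) = 0 := fun b a => by
      rw [iwKernel, Set.indicator_of_notMem]
      intro h
      rw [Set.mem_ofPred_eq, symMatrix_borderedEquiv] at h
      exact hs (posDef_of_bordered h)
    simp [h0]

/-- Passing from `k + 1` to `k` lowers `d` by 2, so the condition `2k < d` is inherited; it also
implies the bound needed for the Schur kernel. -/
lemma lintegral_iwKernel_lt_top (k : ℕ) (d : ℝ) (hd : 2 * (k : ℝ) < d) :
    ∫⁻ s, iwKernel k d s < ⊤ := by
  induction k generalizing d with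
  | zero =>
    have h1 : ∀ s : SymCoord 0, iwKernel 0 d s ≤ 1 := fun s => by
      refine Set.indicator_le' (fun s _ => ?_) (fun _ _ => zero_le (a := (1 : ENNReal))) s
      simp
    refine lt_of_le_of_lt (lintegral_mono h1) ?_
    rw [lintegral_const, one_mul, volume_pi, Measure.pi_univ]
    simp
  | succ k ih =>
    push_cast at hd
    obtain ⟨c, hc⟩ := lintegral_iwKernel_succ_le k d
    refine lt_of_le_of_lt hc (ENNReal.mul_lt_top ENNReal.coe_lt_top
      (ENNReal.mul_lt_top (ih _ (by linarith)) (lintegral_schurKernel_lt_top ?_)))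
    have : (0 : ℝ) ≤ k := k.cast_nonneg
    linarith

/-- Integrating out `μ` produces `det Σ ^ (1 / 2)`, turning the exponent `-(d + 1) / 2` into the
inverse Wishart exponent `-d / 2`. -/
theorem niwMeasure_one_lt_top {κ d : ℝ} (hκ : 0 < κ) (hd : 2 * (k : ℝ) < d) :
    niwMeasure κ (0 : Fin k → ℝ) 1 d Set.univ < ⊤ := by
  rw [niwMeasure_eq_withDensity_indicator, withDensity_apply _ MeasurableSet.univ,
    Measure.restrict_univ, Measure.volume_eq_prod, lintegral_prod_symm _
      ((measurable_niwDensity κ 0 1 d).ennreal_ofReal.indicator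
        measurableSet_posDefParams).aemeasurable]
  have hin : ∀ s : SymCoord k, ∫⁻ μ, (posDefParams k).indicator
      (fun θ => ENNReal.ofReal (niwDensity κ 0 1 d θ)) (μ, s) =
      ENNReal.ofReal (κ ^ (-(k : ℝ) / 2)) * stdGaussianMass k * iwKernel k d s := by
    intro s
    by_cases hs : (symMatrix s).PosDef
    · have hd0 := hs.det_pos
      have hG := lintegral_exp_neg_quadForm (hs.inv.smul hκ)
      rw [Matrix.det_smul, Fintype.card_fin, Matrix.det_nonsing_inv, Ring.inverse_eq_inv',
        ← Real.rpow_natCast, Real.mul_rpow (by positivity) (by positivity),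
        Real.inv_rpow hd0.le, ← Real.rpow_neg hd0.le, ← Real.rpow_mul hκ.le] at hG
      have hfac : ∀ μ : Fin k → ℝ, (posDefParams k).indicator
          (fun θ => ENNReal.ofReal (niwDensity κ 0 1 d θ)) (μ, s) =
          ENNReal.ofReal ((symMatrix s).det ^ (-(d + 1) / 2) *
              Real.exp (-((symMatrix s)⁻¹).trace / 2)) *
            ENNReal.ofReal (Real.exp (-(μ ⬝ᵥ (κ • (symMatrix s)⁻¹) *ᵥ μ) / 2)) := by
        intro μ
        rw [Set.indicator_of_mem (show (μ, s) ∈ posDefParams k from hs), niwDensity,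
          ← ENNReal.ofReal_mul (mul_nonneg (Real.rpow_nonneg hd0.le _) (Real.exp_pos _).le),
          mul_assoc, ← Real.exp_add, Matrix.smul_mulVec, dotProduct_smul, smul_eq_mul, mul_one,
          sub_zero]
        congr 3
        ring
      simp only [hfac]
      rw [lintegral_const_mul' _ _ ENNReal.ofReal_ne_top, hG, iwKernel,
        Set.indicator_of_mem (show s ∈ {s | (symMatrix s).PosDef} from hs), ← mul_assoc,
        mul_right_comm _ (stdGaussianMass k), ← ENNReal.ofReal_mul
          (mul_nonneg (Real.rpow_nonneg hd0.le _) (Real.exp_pos _).le),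
        ← ENNReal.ofReal_mul (by positivity)]
      congr 2
      rw [show -d / 2 = -(d + 1) / 2 + -(-1 / 2) by ring, Real.rpow_add hd0,
        show (k : ℝ) * (-1 / 2) = -(k : ℝ) / 2 by ring]
      ring
    · have h0 : ∀ μ : Fin k → ℝ, (μ, s) ∉ posDefParams k := fun μ => hs
      rw [iwKernel, Set.indicator_of_notMem (show s ∉ {s | (symMatrix s).PosDef} from hs)]
      simp [Set.indicator_of_notMem (h0 _)]
  simp only [hin]
  rw [lintegral_const_mul _ (measurable_iwKernel d)]
  exact ENNReal.mul_lt_top (ENNReal.mul_lt_top ENNReal.ofReal_lt_top (stdGaussianMass_lt_top k))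
    (lintegral_iwKernel_lt_top k d hd)

end Finiteness

/-! ### Moments of the normal-inverse-Wishart measure -/

section Moments

variable {k : ℕ} {κ d : ℝ}

lemma niwMeasure_smul_one_lt_top (hκ : 0 < κ) (hd : 2 * (k : ℝ) < d) {t : ℝ} (ht : 0 < t) :
    niwMeasure κ (0 : Fin k → ℝ) (t • 1) d Set.univ < ⊤ := by
  have h := niwMeasure_one_lt_top (k := k) hκ hd
  rw [niwMeasure_smul_one κ d ht] at h
  exact ENNReal.lt_top_of_mul_ne_top_right h.ne
    (ENNReal.ofReal_pos.2 (Real.rpow_pos_of_pos ht _)).ne'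

/-- Expand the nonnegative forms at `u + v` and `u - v`. -/
lemma abs_dotProduct_mulVec_le {P : Matrix (Fin k) (Fin k) ℝ} (hP : P.PosDef) (u v : Fin k → ℝ) :
    |u ⬝ᵥ P *ᵥ v| ≤ (u ⬝ᵥ P *ᵥ u + v ⬝ᵥ P *ᵥ v) / 2 := by
  have hc := dotProduct_mulVec_comm_of_posDef hP v u
  have h1 : 0 ≤ (u + v) ⬝ᵥ P *ᵥ (u + v) := by
    simpa using hP.posSemidef.dotProduct_mulVec_nonneg (u + v)
  have h2 : 0 ≤ (u - v) ⬝ᵥ P *ᵥ (u - v) := by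
    simpa using hP.posSemidef.dotProduct_mulVec_nonneg (u - v)
  simp only [Matrix.mulVec_add, Matrix.mulVec_sub, add_dotProduct, sub_dotProduct,
    dotProduct_add, dotProduct_sub, hc] at h1 h2
  rw [abs_le]
  constructor <;> linarith

lemma single_dotProduct_mulVec_single (P : Matrix (Fin k) (Fin k) ℝ) (i j : Fin k) :
    Pi.single i 1 ⬝ᵥ P *ᵥ Pi.single j 1 = P i j := by
  simp

lemma apply_le_trace {P : Matrix (Fin k) (Fin k) ℝ} (hP : P.PosDef) (i : Fin k) :
    P i i ≤ P.trace :=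
  Finset.single_le_sum (f := fun i => P i i) (fun _ _ => hP.posSemidef.diag_nonneg)
    (Finset.mem_univ i)

lemma abs_apply_le_trace {P : Matrix (Fin k) (Fin k) ℝ} (hP : P.PosDef) (i j : Fin k) :
    |P i j| ≤ P.trace := by
  have h := abs_dotProduct_mulVec_le hP (Pi.single i 1) (Pi.single j 1)
  simp only [single_dotProduct_mulVec_single] at h
  linarith [apply_le_trace hP i, apply_le_trace hP j]

lemma abs_mulVec_apply_le {P : Matrix (Fin k) (Fin k) ℝ} (hP : P.PosDef) (v : Fin k → ℝ)
    (i : Fin k) : |(P *ᵥ v) i| ≤ P.trace + v ⬝ᵥ P *ᵥ v := by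
  have h := abs_dotProduct_mulVec_le hP (Pi.single i 1) v
  have h0 : 0 ≤ v ⬝ᵥ P *ᵥ v := by simpa using hP.posSemidef.dotProduct_mulVec_nonneg v
  have htr : 0 ≤ P.trace := hP.posSemidef.trace_nonneg
  rw [single_dotProduct_mulVec_single, single_dotProduct, one_mul] at h
  linarith [apply_le_trace hP i]

/-- Functions of at most linear growth in `tr Σ⁻¹` and `μᵀ Σ⁻¹ μ` are integrable. -/
lemma integrable_niwMeasure_of_le (hκ : 0 < κ) (hd : 2 * (k : ℝ) < d)
    {g : (Fin k → ℝ) × SymCoord k → ℝ} (hg : Measurable g) {C : ℝ} (hC : 0 ≤ C)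
    (hle : ∀ θ ∈ posDefParams k, |g θ| ≤
      C * (κ * (θ.1 ⬝ᵥ (symMatrix θ.2)⁻¹ *ᵥ θ.1) + ((symMatrix θ.2)⁻¹).trace)) :
    Integrable g (niwMeasure κ (0 : Fin k → ℝ) 1 d) := by
  refine ⟨hg.aestronglyMeasurable, ?_⟩
  -- Half of the exponential decay absorbs the linear factor: `Q exp (-Q/2) ≤ 4 exp (-Q/4)`, and the
  -- right side is the kernel with `κ` and the scale matrix both halved.
  have hfin := niwMeasure_smul_one_lt_top (k := k) (half_pos hκ) hd (t := 1 / 2) (by norm_num)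
  rw [niwMeasure, withDensity_apply _ MeasurableSet.univ, Measure.restrict_univ] at hfin
  rw [HasFiniteIntegral, niwMeasure, lintegral_withDensity_eq_lintegral_mul _
    (measurable_niwDensity κ 0 1 d).ennreal_ofReal hg.enorm]
  refine lt_of_le_of_lt ?_ (ENNReal.mul_lt_top (ENNReal.ofReal_lt_top (r := 4 * C)) hfin)
  rw [← lintegral_const_mul' _ _ ENNReal.ofReal_ne_top, paramMeasure_eq]
  refine setLIntegral_mono' measurableSet_posDefParams fun θ hθ => ?_
  have hpos := niwDensity_pos κ 0 1 d hθ
  have hdet : 0 < (symMatrix θ.2).det := Matrix.PosDef.det_pos hθ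
  rw [Pi.mul_apply, Real.enorm_eq_ofReal_abs, ← ENNReal.ofReal_mul hpos.le,
    ← ENNReal.ofReal_mul (by positivity)]
  refine ENNReal.ofReal_le_ofReal ?_
  set Q := κ * (θ.1 ⬝ᵥ (symMatrix θ.2)⁻¹ *ᵥ θ.1) + ((symMatrix θ.2)⁻¹).trace with hQ
  have h1 : niwDensity κ 0 1 d θ =
      (symMatrix θ.2).det ^ (-(d + 1) / 2) * Real.exp (-Q / 2) := by
    rw [niwDensity, sub_zero, mul_one]
  have h2 : niwDensity (κ / 2) 0 ((1 / 2 : ℝ) • 1) d θ =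
      (symMatrix θ.2).det ^ (-(d + 1) / 2) * Real.exp (-Q / 4) := by
    rw [niwDensity, sub_zero, Matrix.mul_smul, mul_one, Matrix.trace_smul, smul_eq_mul]
    congr 2
    rw [hQ]; ring
  have h3 : Q * Real.exp (-Q / 2) ≤ 4 * Real.exp (-Q / 4) := by
    have : Q / 4 ≤ Real.exp (Q / 4) := (le_add_of_nonneg_right zero_le_one).trans
      (Real.add_one_le_exp _)
    calc Q * Real.exp (-Q / 2) = 4 * (Q / 4) * Real.exp (-Q / 2) := by ring
      _ ≤ 4 * Real.exp (Q / 4) * Real.exp (-Q / 2) := by gcongr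
      _ = 4 * Real.exp (-Q / 4) := by
        rw [mul_assoc, ← Real.exp_add]; congr 2; ring
  rw [h1, h2]
  have hD : 0 ≤ (symMatrix θ.2).det ^ (-(d + 1) / 2) := Real.rpow_nonneg hdet.le _
  calc (symMatrix θ.2).det ^ (-(d + 1) / 2) * Real.exp (-Q / 2) * |g θ|
      ≤ (symMatrix θ.2).det ^ (-(d + 1) / 2) * Real.exp (-Q / 2) * (C * Q) :=
        mul_le_mul_of_nonneg_left (hle θ hθ) (mul_nonneg hD (Real.exp_pos _).le)
    _ = (symMatrix θ.2).det ^ (-(d + 1) / 2) * C * (Q * Real.exp (-Q / 2)) := by ring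
    _ ≤ (symMatrix θ.2).det ^ (-(d + 1) / 2) * C * (4 * Real.exp (-Q / 4)) :=
        mul_le_mul_of_nonneg_left h3 (mul_nonneg hD hC)
    _ = _ := by ring

lemma quadForm_inv_nonneg {θ : (Fin k → ℝ) × SymCoord k} (hθ : θ ∈ posDefParams k) :
    0 ≤ θ.1 ⬝ᵥ (symMatrix θ.2)⁻¹ *ᵥ θ.1 := by
  have h : (symMatrix θ.2)⁻¹.PosDef := Matrix.PosDef.inv hθ
  simpa using h.posSemidef.dotProduct_mulVec_nonneg θ.1

lemma measurable_inv_apply (i j : Fin k) :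
    Measurable fun θ : (Fin k → ℝ) × SymCoord k => (symMatrix θ.2)⁻¹ i j :=
  (measurable_inv_symMatrix i j).comp measurable_snd

lemma measurable_inv_mulVec_apply (i : Fin k) :
    Measurable fun θ : (Fin k → ℝ) × SymCoord k => ((symMatrix θ.2)⁻¹ *ᵥ θ.1) i := by
  simp only [Matrix.mulVec, dotProduct]
  exact Finset.measurable_fun_sum _ fun j _ =>
    (measurable_inv_apply i j).mul ((measurable_pi_apply j).comp measurable_fst)

lemma integrable_inv_apply (hκ : 0 < κ) (hd : 2 * (k : ℝ) < d) (i j : Fin k) :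
    Integrable (fun θ => (symMatrix θ.2)⁻¹ i j) (niwMeasure κ (0 : Fin k → ℝ) 1 d) := by
  refine integrable_niwMeasure_of_le hκ hd (measurable_inv_apply i j) zero_le_one fun θ hθ => ?_
  have h : (symMatrix θ.2)⁻¹.PosDef := Matrix.PosDef.inv hθ
  have := mul_nonneg hκ.le (quadForm_inv_nonneg hθ)
  linarith [abs_apply_le_trace h i j]

lemma integrable_inv_mulVec_apply (hκ : 0 < κ) (hd : 2 * (k : ℝ) < d) (i : Fin k) :
    Integrable (fun θ => ((symMatrix θ.2)⁻¹ *ᵥ θ.1) i) (niwMeasure κ (0 : Fin k → ℝ) 1 d) := by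
  -- The `κ⁻¹` restores the unit coefficient of the quadratic form, the `1` covers the trace.
  refine integrable_niwMeasure_of_le hκ hd (measurable_inv_mulVec_apply i) (C := 1 + κ⁻¹)
    (by positivity) fun θ hθ => ?_
  have h : (symMatrix θ.2)⁻¹.PosDef := Matrix.PosDef.inv hθ
  have hq := quadForm_inv_nonneg hθ
  have htr : 0 ≤ (symMatrix θ.2)⁻¹.trace := h.posSemidef.trace_nonneg
  have h1 := abs_mulVec_apply_le h θ.1 i
  have h2 : (1 + κ⁻¹) * (κ * (θ.1 ⬝ᵥ (symMatrix θ.2)⁻¹ *ᵥ θ.1) + (symMatrix θ.2)⁻¹.trace) =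
      θ.1 ⬝ᵥ (symMatrix θ.2)⁻¹ *ᵥ θ.1 + (symMatrix θ.2)⁻¹.trace +
        (κ * (θ.1 ⬝ᵥ (symMatrix θ.2)⁻¹ *ᵥ θ.1) + κ⁻¹ * (symMatrix θ.2)⁻¹.trace) := by
    field_simp
    ring
  have h3 : 0 ≤ κ * (θ.1 ⬝ᵥ (symMatrix θ.2)⁻¹ *ᵥ θ.1) + κ⁻¹ * (symMatrix θ.2)⁻¹.trace := by
    positivity
  linarith

/-- Invariance under the orthogonal group. -/
lemma map_paramMap_niwMeasure_of_orthogonal (hκ : 0 < κ) (hd : 2 * (k : ℝ) < d)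
    {A : Matrix (Fin k) (Fin k) ℝ} (hA : A * Aᵀ = 1) :
    (niwMeasure κ (0 : Fin k → ℝ) 1 d).map (paramMap A 0) = niwMeasure κ 0 1 d := by
  have hdet : A.det ≠ 0 := fun h => by
    have := congrArg Matrix.det hA
    simp [h] at this
  have h := map_paramMap_niwMeasure κ 0 1 d hdet
  rw [mul_one, hA] at h
  have huniv := congrArg (fun ν => ν Set.univ) h
  simp only [Measure.smul_apply, smul_eq_mul] at huniv
  rw [Measure.map_apply (measurable_paramMap _ _) MeasurableSet.univ, Set.preimage_univ] at huniv
  -- The Jacobian constant must be 1: both sides have the same total mass, which is finite and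
  -- nonzero.
  have hc := (ENNReal.eq_div_iff (niwMeasure_univ_ne_zero κ (0 : Fin k → ℝ) 1 d)
    (niwMeasure_one_lt_top hκ hd).ne).2 ((mul_comm _ _).trans huniv.symm)
  rw [ENNReal.div_self (niwMeasure_univ_ne_zero κ (0 : Fin k → ℝ) 1 d)
    (niwMeasure_one_lt_top hκ hd).ne] at hc
  rw [h, hc, one_smul]

lemma integral_comp_paramMap_of_orthogonal (hκ : 0 < κ) (hd : 2 * (k : ℝ) < d)
    {A : Matrix (Fin k) (Fin k) ℝ} (hA : A * Aᵀ = 1) {f : (Fin k → ℝ) × SymCoord k → ℝ}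
    (hf : Measurable f) :
    ∫ θ, f (paramMap A 0 θ) ∂(niwMeasure κ (0 : Fin k → ℝ) 1 d) =
      ∫ θ, f θ ∂(niwMeasure κ (0 : Fin k → ℝ) 1 d) := by
  conv_rhs => rw [← map_paramMap_niwMeasure_of_orthogonal hκ hd hA]
  rw [integral_map (measurable_paramMap A 0).aemeasurable hf.aestronglyMeasurable]

lemma inv_symMatrix_paramMap_of_orthogonal {A : Matrix (Fin k) (Fin k) ℝ} (hA : A * Aᵀ = 1)
    (m : Fin k → ℝ) (θ : (Fin k → ℝ) × SymCoord k) :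
    (symMatrix (paramMap A m θ).2)⁻¹ = A * (symMatrix θ.2)⁻¹ * Aᵀ := by
  have hinv : A⁻¹ = Aᵀ := Matrix.inv_eq_right_inv hA
  rw [paramMap, symMatrix_symConj, inv_conj, hinv, Matrix.transpose_transpose]

lemma integral_inv_mulVec_apply (hκ : 0 < κ) (hd : 2 * (k : ℝ) < d) (i : Fin k) :
    ∫ θ, ((symMatrix θ.2)⁻¹ *ᵥ θ.1) i ∂(niwMeasure κ (0 : Fin k → ℝ) 1 d) = 0 := by
  -- The matrix `-1` fixes `Σ` and negates `μ`, so the integral equals its own negative.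
  have hA : (-1 : Matrix (Fin k) (Fin k) ℝ) * (-1)ᵀ = 1 := by simp
  have h := integral_comp_paramMap_of_orthogonal hκ hd hA (measurable_inv_mulVec_apply i)
  simp only [inv_symMatrix_paramMap_of_orthogonal hA] at h
  simp only [paramMap, neg_mul, one_mul, Matrix.transpose_neg, Matrix.transpose_one, mul_neg,
    mul_one, neg_neg, zero_add, Matrix.neg_mulVec, Matrix.one_mulVec, Matrix.mulVec_neg,
    Pi.neg_apply, integral_neg] at h
  linarith

lemma integral_inv_apply_of_ne (hκ : 0 < κ) (hd : 2 * (k : ℝ) < d) {i j : Fin k} (hij : i ≠ j) :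
    ∫ θ, (symMatrix θ.2)⁻¹ i j ∂(niwMeasure κ (0 : Fin k → ℝ) 1 d) = 0 := by
  -- Reversing coordinate `i` alone negates the off-diagonal entry `(i, j)`.
  set A : Matrix (Fin k) (Fin k) ℝ := Matrix.diagonal fun l => if l = i then -1 else 1 with hAdef
  have hA : A * Aᵀ = 1 := by
    rw [hAdef, Matrix.diagonal_transpose, Matrix.diagonal_mul_diagonal, ← Matrix.diagonal_one]
    congr 1
    ext l
    split_ifs <;> simp
  have h := integral_comp_paramMap_of_orthogonal hκ hd hA (measurable_inv_apply i j)
  simp only [inv_symMatrix_paramMap_of_orthogonal hA] at h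
  simp only [hAdef, Matrix.diagonal_transpose, Matrix.mul_diagonal, Matrix.diagonal_mul, if_true, if_neg hij.symm, neg_mul, one_mul, mul_one,
    integral_neg] at h
  linarith

lemma integral_inv_apply_diag_eq (hκ : 0 < κ) (hd : 2 * (k : ℝ) < d) (i j : Fin k) :
    ∫ θ, (symMatrix θ.2)⁻¹ i i ∂(niwMeasure κ (0 : Fin k → ℝ) 1 d) =
      ∫ θ, (symMatrix θ.2)⁻¹ j j ∂(niwMeasure κ (0 : Fin k → ℝ) 1 d) := by
  set A : Matrix (Fin k) (Fin k) ℝ := (Equiv.swap j i).toPEquiv.toMatrix with hAdef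
  have hconj : ∀ M : Matrix (Fin k) (Fin k) ℝ,
      A * M * Aᵀ = M.submatrix (Equiv.swap j i) (Equiv.swap j i) := fun M => by
    rw [hAdef, PEquiv.toMatrix_toPEquiv_mul, ← PEquiv.toMatrix_symm, ← Equiv.toPEquiv_symm,
      PEquiv.mul_toMatrix_toPEquiv]
    rfl
  have hA : A * Aᵀ = 1 := by
    have := hconj 1
    rwa [mul_one, Matrix.submatrix_one_equiv] at this
  have h := integral_comp_paramMap_of_orthogonal hκ hd hA (measurable_inv_apply j j)
  simp only [inv_symMatrix_paramMap_of_orthogonal hA, hconj, Matrix.submatrix_apply,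
    Equiv.swap_apply_left] at h
  exact h

lemma measurable_trace_inv' :
    Measurable fun θ : (Fin k → ℝ) × SymCoord k => ((symMatrix θ.2)⁻¹).trace :=
  Finset.measurable_fun_sum _ fun i _ => measurable_inv_apply i i

/-- Viewing `S = t • 1` as an exponential tilt of the kernel with `S = 0` makes the total mass a
moment generating function of `tr Σ⁻¹`, at `u = -t / 2`. Finiteness of the untilted measure is not
required. -/
lemma niwMeasure_smul_one_eq_withDensity (κ d t : ℝ) :
    niwMeasure κ (0 : Fin k → ℝ) (t • 1) d = (niwMeasure κ (0 : Fin k → ℝ) 0 d).withDensity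
      fun θ => ENNReal.ofReal (Real.exp (-t / 2 * ((symMatrix θ.2)⁻¹).trace)) := by
  rw [niwMeasure, niwMeasure, ← withDensity_mul _ (measurable_niwDensity κ 0 0 d).ennreal_ofReal
    (measurable_trace_inv'.const_mul _).exp.ennreal_ofReal]
  congr 1
  ext θ
  rw [Pi.mul_apply, ← ENNReal.ofReal_mul' (Real.exp_pos _).le, niwDensity, niwDensity, mul_assoc,
    ← Real.exp_add, Matrix.mul_smul, mul_one, mul_zero, Matrix.trace_zero, Matrix.trace_smul,
    smul_eq_mul]
  congr 3
  ring

lemma lintegral_exp_trace_inv (κ d t : ℝ) :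
    ∫⁻ θ, ENNReal.ofReal (Real.exp (-t / 2 * ((symMatrix θ.2)⁻¹).trace))
      ∂(niwMeasure κ (0 : Fin k → ℝ) 0 d) = niwMeasure κ (0 : Fin k → ℝ) (t • 1) d Set.univ := by
  rw [niwMeasure_smul_one_eq_withDensity, withDensity_apply _ MeasurableSet.univ,
    Measure.restrict_univ]

lemma integrable_exp_trace_inv (hκ : 0 < κ) (hd : 2 * (k : ℝ) < d) {u : ℝ} (hu : u < 0) :
    Integrable (fun θ => Real.exp (u * ((symMatrix θ.2)⁻¹).trace))
      (niwMeasure κ (0 : Fin k → ℝ) 0 d) := by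
  refine ⟨(measurable_trace_inv'.const_mul _).exp.aestronglyMeasurable, ?_⟩
  rw [hasFiniteIntegral_iff_ofReal (Filter.Eventually.of_forall fun θ => (Real.exp_pos _).le)]
  have h := lintegral_exp_trace_inv (k := k) κ d (-2 * u)
  rw [show -(-2 * u) / 2 = u by ring] at h
  rw [h]
  exact niwMeasure_smul_one_lt_top hκ hd (by linarith)

lemma mgf_trace_inv (κ d : ℝ) {u : ℝ} (hu : u < 0) :
    mgf (fun θ => ((symMatrix θ.2)⁻¹).trace) (niwMeasure κ (0 : Fin k → ℝ) 0 d) u =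
      (-2 * u) ^ (-((k : ℝ) * (d - k - 1) / 2)) *
        (niwMeasure κ (0 : Fin k → ℝ) 1 d).real Set.univ := by
  have hu2 : 0 < -2 * u := by linarith
  have h := lintegral_exp_trace_inv (k := k) κ d (-2 * u)
  rw [show -(-2 * u) / 2 = u by ring] at h
  rw [mgf, integral_eq_lintegral_of_nonneg_ae
    (Filter.Eventually.of_forall fun θ => (Real.exp_pos _).le)
    (measurable_trace_inv'.const_mul _).exp.aestronglyMeasurable, h, Measure.real,
    niwMeasure_smul_one κ d hu2, ENNReal.toReal_mul,
    ENNReal.toReal_ofReal (Real.rpow_nonneg hu2.le _), ← mul_assoc, ← Real.rpow_add hu2,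
    neg_add_cancel, Real.rpow_zero, one_mul]

/-- Differentiate the moment generating function at `u = -1/2`, where the tilted measure has scale
matrix 1: once under the integral, once through its explicit power form. -/
lemma integral_trace_inv (hκ : 0 < κ) (hd : 2 * (k : ℝ) < d) :
    ∫ θ, ((symMatrix θ.2)⁻¹).trace ∂(niwMeasure κ (0 : Fin k → ℝ) 1 d) =
      k * (d - k - 1) * (niwMeasure κ (0 : Fin k → ℝ) 1 d).real Set.univ := by
  set X : (Fin k → ℝ) × SymCoord k → ℝ := fun θ => ((symMatrix θ.2)⁻¹).trace with hX
  set ρ := niwMeasure κ (0 : Fin k → ℝ) 0 d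
  have hsub : Set.Iio 0 ⊆ integrableExpSet X ρ := fun u hu => integrable_exp_trace_inv hκ hd hu
  have hmem : (-(1 / 2) : ℝ) ∈ interior (integrableExpSet X ρ) :=
    interior_mono hsub (by rw [interior_Iio, Set.mem_Iio]; norm_num)
  have h1 := hasDerivAt_mgf hmem
  have h2 : HasDerivAt (fun u : ℝ => (-2 * u) ^ (-((k : ℝ) * (d - k - 1) / 2)) *
      (niwMeasure κ (0 : Fin k → ℝ) 1 d).real Set.univ)
      (k * (d - k - 1) * (niwMeasure κ (0 : Fin k → ℝ) 1 d).real Set.univ) (-(1 / 2)) := by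
    have h3 : HasDerivAt (fun u : ℝ => -2 * u) (-2 * 1) (-(1 / 2)) :=
      (hasDerivAt_id _).const_mul _
    have h4 := (h3.rpow_const (p := -((k : ℝ) * (d - k - 1) / 2))
      (Or.inl (by norm_num))).mul_const ((niwMeasure κ (0 : Fin k → ℝ) 1 d).real Set.univ)
    refine h4.congr_deriv ?_
    rw [show (-2 : ℝ) * -(1 / 2) = 1 by norm_num, Real.one_rpow]
    ring
  have heq : mgf X ρ =ᶠ[nhds (-(1 / 2))] fun u => (-2 * u) ^ (-((k : ℝ) * (d - k - 1) / 2)) *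
      (niwMeasure κ (0 : Fin k → ℝ) 1 d).real Set.univ := by
    filter_upwards [Iio_mem_nhds (show (-(1 / 2) : ℝ) < 0 by norm_num)] with u hu
    exact mgf_trace_inv κ d hu
  have h5 := h1.unique (h2.congr_of_eventuallyEq heq)
  rw [← h5]
  have h6 := niwMeasure_smul_one_eq_withDensity (k := k) κ d 1
  rw [one_smul] at h6
  rw [h6, integral_withDensity_eq_integral_toReal_smul
    (measurable_trace_inv'.const_mul _).exp.ennreal_ofReal
    (Filter.Eventually.of_forall fun _ => ENNReal.ofReal_lt_top)]
  refine integral_congr_ae (Filter.Eventually.of_forall fun θ => ?_)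
  simp only [ENNReal.toReal_ofReal (Real.exp_pos _).le, smul_eq_mul]
  rw [mul_comm, show (-1 : ℝ) / 2 = -(1 / 2) by norm_num]

theorem integral_inv_apply (hκ : 0 < κ) (hd : 2 * (k : ℝ) < d) (i j : Fin k) :
    ∫ θ, (symMatrix θ.2)⁻¹ i j ∂(niwMeasure κ (0 : Fin k → ℝ) 1 d) =
      (d - k - 1) * (niwMeasure κ (0 : Fin k → ℝ) 1 d).real Set.univ *
        (1 : Matrix (Fin k) (Fin k) ℝ) i j := by
  by_cases hij : i = j
  · subst hij
    have h := integral_trace_inv (k := k) hκ hd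
    simp only [Matrix.trace, Matrix.diag] at h
    rw [integral_finsetSum _ fun j _ => integrable_inv_apply hκ hd j j,
      Finset.sum_congr rfl fun j _ => integral_inv_apply_diag_eq hκ hd j i, Finset.sum_const,
      Finset.card_univ, Fintype.card_fin, nsmul_eq_mul, mul_assoc] at h
    -- The equal diagonal means share the trace; dividing by `k` is legitimate because the index `i`
    -- exists.
    have hk : (k : ℝ) ≠ 0 := by
      have := i.pos
      positivity
    rw [Matrix.one_apply_eq, mul_one]
    exact mul_left_cancel₀ hk h
  · rw [integral_inv_apply_of_ne hκ hd hij, Matrix.one_apply_ne hij, mul_zero]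

end Moments

/-! ### The posterior mean -/

section Posterior

variable {k n : ℕ} {κ d : ℝ}

lemma normalize_smul {α : Type*} [MeasurableSpace α] (N : Measure α) {c : ENNReal} (hc : c ≠ 0)
    (hc' : c ≠ ⊤) : ((c • N) Set.univ)⁻¹ • (c • N) = (N Set.univ)⁻¹ • N := by
  rw [Measure.smul_apply, smul_eq_mul, ENNReal.mul_inv (Or.inl hc) (Or.inl hc'), smul_smul,
    mul_right_comm, ENNReal.inv_mul_cancel hc hc', one_mul]

lemma normalize_niwMeasure_eq_map (κ d : ℝ) (m : Fin k → ℝ) {A : Matrix (Fin k) (Fin k) ℝ}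
    (hA : A.det ≠ 0) :
    (niwMeasure κ m (A * Aᵀ) d Set.univ)⁻¹ • niwMeasure κ m (A * Aᵀ) d =
      ((niwMeasure κ (0 : Fin k → ℝ) 1 d Set.univ)⁻¹ • niwMeasure κ 0 1 d).map
        (paramMap A m) := by
  have h := map_paramMap_niwMeasure κ m 1 d hA
  rw [mul_one] at h
  have huniv : (niwMeasure κ (0 : Fin k → ℝ) 1 d) Set.univ =
      ((niwMeasure κ (0 : Fin k → ℝ) 1 d).map (paramMap A m)) Set.univ := by
    rw [Measure.map_apply (measurable_paramMap A m) MeasurableSet.univ, Set.preimage_univ]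
  rw [Measure.map_smul, huniv, h, normalize_smul _ _ ENNReal.ofReal_ne_top]
  refine (ENNReal.ofReal_pos.2 (mul_pos (Real.rpow_pos_of_pos (abs_pos.2 hA) _)
    (abs_pos.2 (inv_ne_zero (mul_ne_zero hA (det_symConj_ne_zero hA)))))).ne'

lemma isProbabilityMeasure_normalize_niwMeasure (hκ : 0 < κ) (hd : 2 * (k : ℝ) < d) :
    IsProbabilityMeasure
      ((niwMeasure κ (0 : Fin k → ℝ) 1 d Set.univ)⁻¹ • niwMeasure κ (0 : Fin k → ℝ) 1 d) :=
  ⟨by rw [Measure.smul_apply, smul_eq_mul, ENNReal.inv_mul_cancel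
    (niwMeasure_univ_ne_zero _ _ _ _) (niwMeasure_one_lt_top hκ hd).ne]⟩

/-- This splits the integrand into a part linear in `Σ⁻¹` and a part `Σ⁻¹ μ` of mean zero. The outer
factors `(A⁻¹)ᵀ` and `A⁻¹` later recombine to `(A Aᵀ)⁻¹`. -/
lemma inv_mulVec_paramMap {A : Matrix (Fin k) (Fin k) ℝ} (hA : A.det ≠ 0) (m v : Fin k → ℝ)
    (θ : (Fin k → ℝ) × SymCoord k) :
    (symMatrix (paramMap A m θ).2)⁻¹ *ᵥ ((paramMap A m θ).1 - v) =
      (A⁻¹)ᵀ *ᵥ ((symMatrix θ.2)⁻¹ *ᵥ (A⁻¹ *ᵥ (m - v)) + (symMatrix θ.2)⁻¹ *ᵥ θ.1) := by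
  rw [paramMap, symMatrix_symConj, inv_conj, ← Matrix.mulVec_mulVec, ← Matrix.mulVec_mulVec,
    ← Matrix.mulVec_add, add_sub_right_comm, Matrix.mulVec_add A⁻¹, Matrix.mulVec_mulVec _ A⁻¹ A,
    Matrix.nonsing_inv_mul _ (isUnit_iff_ne_zero.2 hA), Matrix.one_mulVec]

lemma integral_normalize_inv_mulVec (hκ : 0 < κ) (hd : 2 * (k : ℝ) < d)
    (B : Matrix (Fin k) (Fin k) ℝ) (u : Fin k → ℝ) (i : Fin k) :
    Integrable (fun θ => (B *ᵥ ((symMatrix θ.2)⁻¹ *ᵥ u + (symMatrix θ.2)⁻¹ *ᵥ θ.1)) i)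
        (niwMeasure κ (0 : Fin k → ℝ) 1 d) ∧
      ∫ θ, (B *ᵥ ((symMatrix θ.2)⁻¹ *ᵥ u + (symMatrix θ.2)⁻¹ *ᵥ θ.1)) i
        ∂(niwMeasure κ (0 : Fin k → ℝ) 1 d) =
      (niwMeasure κ (0 : Fin k → ℝ) 1 d).real Set.univ * ((d - k - 1) * (B *ᵥ u) i) := by
  have hI1 : ∀ j l, Integrable (fun θ => (symMatrix θ.2)⁻¹ j l * u l)
      (niwMeasure κ (0 : Fin k → ℝ) 1 d) := fun j l => (integrable_inv_apply hκ hd j l).mul_const _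
  have hI2 : ∀ j, Integrable (fun θ => ((symMatrix θ.2)⁻¹ *ᵥ u) j)
      (niwMeasure κ (0 : Fin k → ℝ) 1 d) := fun j => by
    simp only [Matrix.mulVec, dotProduct]
    exact integrable_finsetSum _ fun l _ => hI1 j l
  have hI3 : ∀ j, Integrable (fun θ => B i j * (((symMatrix θ.2)⁻¹ *ᵥ u) j +
      ((symMatrix θ.2)⁻¹ *ᵥ θ.1) j)) (niwMeasure κ (0 : Fin k → ℝ) 1 d) := fun j =>
    ((hI2 j).add (integrable_inv_mulVec_apply hκ hd j)).const_mul _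
  have hE2 : ∀ j, ∫ θ, ((symMatrix θ.2)⁻¹ *ᵥ u) j ∂(niwMeasure κ (0 : Fin k → ℝ) 1 d) =
      (niwMeasure κ (0 : Fin k → ℝ) 1 d).real Set.univ * ((d - k - 1) * u j) := fun j => by
    have h : ∀ θ : (Fin k → ℝ) × SymCoord k, ((symMatrix θ.2)⁻¹ *ᵥ u) j =
        ∑ l, (symMatrix θ.2)⁻¹ j l * u l := fun θ => rfl
    simp only [h]
    rw [integral_finsetSum _ fun l _ => hI1 j l]
    simp only [integral_mul_const, integral_inv_apply hκ hd, Matrix.one_apply, mul_ite, mul_one,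
      mul_zero, ite_mul, zero_mul, Finset.sum_ite_eq, Finset.mem_univ, if_true]
    ring
  have hfun : ∀ θ : (Fin k → ℝ) × SymCoord k,
      (B *ᵥ ((symMatrix θ.2)⁻¹ *ᵥ u + (symMatrix θ.2)⁻¹ *ᵥ θ.1)) i =
      ∑ j, B i j * (((symMatrix θ.2)⁻¹ *ᵥ u) j + ((symMatrix θ.2)⁻¹ *ᵥ θ.1) j) := fun θ => rfl
  simp only [hfun]
  refine ⟨integrable_finsetSum _ fun j _ => hI3 j, ?_⟩
  rw [integral_finsetSum _ fun j _ => hI3 j]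
  have hE3 : ∀ j, ∫ θ, B i j * (((symMatrix θ.2)⁻¹ *ᵥ u) j + ((symMatrix θ.2)⁻¹ *ᵥ θ.1) j)
      ∂(niwMeasure κ (0 : Fin k → ℝ) 1 d) =
      (niwMeasure κ (0 : Fin k → ℝ) 1 d).real Set.univ * ((d - k - 1) * (B i j * u j)) :=
    fun j => by
      rw [integral_const_mul, integral_add (hI2 j) (integrable_inv_mulVec_apply hκ hd j), hE2,
        integral_inv_mulVec_apply hκ hd]
      ring
  simp only [hE3]
  simp only [Matrix.mulVec, dotProduct, Finset.mul_sum]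

/-- The mean of `c Σ⁻¹ (μ - v)` under the normal-inverse-Wishart distribution. -/
theorem niw_mean (hκ : 0 < κ) (hd : 2 * (k : ℝ) < d) (m v : Fin k → ℝ)
    {S : Matrix (Fin k) (Fin k) ℝ} (hS : S.PosDef) (c : ℝ) {P : Measure ((Fin k → ℝ) × SymCoord k)}
    (hP : P = (niwMeasure κ m S d Set.univ)⁻¹ • niwMeasure κ m S d) :
    IsProbabilityMeasure P ∧
      Integrable (fun θ => c • ((symMatrix θ.2)⁻¹ *ᵥ (θ.1 - v))) P ∧
      ∫ θ, c • ((symMatrix θ.2)⁻¹ *ᵥ (θ.1 - v)) ∂P =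
        (c * (d - k - 1)) • (S⁻¹ *ᵥ (m - v)) := by
  obtain ⟨A, hA, rfl⟩ := exists_eq_mul_transpose hS
  rw [normalize_niwMeasure_eq_map κ d m hA] at hP
  have hprob := isProbabilityMeasure_normalize_niwMeasure (k := k) hκ hd
  set ν := niwMeasure κ (0 : Fin k → ℝ) 1 d with hν
  have hν0 : ν Set.univ ≠ 0 := niwMeasure_univ_ne_zero _ _ _ _
  have hνt : ν Set.univ ≠ ⊤ := (niwMeasure_one_lt_top hκ hd).ne
  have hT := measurable_paramMap A m
  have hm : ∀ i, Measurable fun θ : (Fin k → ℝ) × SymCoord k =>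
      (c • ((symMatrix θ.2)⁻¹ *ᵥ (θ.1 - v))) i := fun i => by
    simp only [Pi.smul_apply, Matrix.mulVec, dotProduct, Pi.sub_apply, smul_eq_mul]
    exact (Finset.measurable_fun_sum _ fun j _ => (measurable_inv_apply i j).mul
      (((measurable_pi_apply j).comp measurable_fst).sub_const _)).const_mul _
  have hcomp : ∀ i θ, (c • ((symMatrix (paramMap A m θ).2)⁻¹ *ᵥ ((paramMap A m θ).1 - v))) i =
      c * ((A⁻¹)ᵀ *ᵥ ((symMatrix θ.2)⁻¹ *ᵥ (A⁻¹ *ᵥ (m - v)) + (symMatrix θ.2)⁻¹ *ᵥ θ.1)) i :=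
    fun i θ => by rw [inv_mulVec_paramMap hA, Pi.smul_apply, smul_eq_mul]
  have hint : ∀ i, Integrable (fun θ => (c • ((symMatrix θ.2)⁻¹ *ᵥ (θ.1 - v))) i) P := fun i => by
    rw [hP, integrable_map_measure (hm i).aestronglyMeasurable hT.aemeasurable]
    refine Integrable.smul_measure ?_ (ENNReal.inv_ne_top.2 hν0)
    simp only [Function.comp_def, hcomp]
    exact (integral_normalize_inv_mulVec hκ hd _ _ i).1.const_mul c
  refine ⟨?_, Integrable.of_eval hint, ?_⟩
  · rw [hP]
    exact Measure.isProbabilityMeasure_map hT.aemeasurable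
  · ext i
    rw [eval_integral hint, hP, integral_map hT.aemeasurable (hm i).aestronglyMeasurable,
      integral_smul_measure]
    simp only [hcomp]
    rw [integral_const_mul, (integral_normalize_inv_mulVec hκ hd _ _ i).2, ← hν, Measure.real,
      ENNReal.toReal_inv, Matrix.mulVec_mulVec, Matrix.mul_inv_rev, ← Matrix.transpose_nonsing_inv,
      Pi.smul_apply, smul_eq_mul, smul_eq_mul]
    have : (ν Set.univ).toReal ≠ 0 := (ENNReal.toReal_pos hν0 hνt).ne'
    field_simp

/-- Normalisation cancels `C`, so a prior enters only through the kernel parameters it produces on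
the positive definite cone. -/
theorem hasPosteriorMean_weight (hκ : 0 < κ) (hd : 2 * (k : ℝ) < d) (m : Fin k → ℝ)
    {S : Matrix (Fin k) (Fin k) ℝ} (hS : S.PosDef)
    {prior : (Fin k → ℝ) → Matrix (Fin k) (Fin k) ℝ → ℝ} {x : Fin n → Fin k → ℝ} {C : ℝ}
    (hC : 0 < C)
    (hprior : ∀ θ ∈ posDefParams k, likelihood x θ.1 (symMatrix θ.2) * prior θ.1 (symMatrix θ.2) =
      C * niwDensity κ m S d θ) (γ W : ℝ) (r : ℕ → ℝ) (T t : ℕ) :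
    HasPosteriorMean prior x (weight γ r T t W)
      ((coefC γ r T t W * (d - k - 1)) • (S⁻¹ *ᵥ fun i => m i - r (t + 1))) := by
  have h1 : unnormPosterior prior x = ENNReal.ofReal C • niwMeasure κ m S d := by
    rw [unnormPosterior, niwMeasure, ← withDensity_smul _
      (measurable_niwDensity κ m S d).ennreal_ofReal]
    refine withDensity_congr_ae ?_
    rw [paramMeasure_eq]
    filter_upwards [ae_restrict_mem measurableSet_posDefParams] with θ hθ
    rw [hprior θ hθ, ENNReal.ofReal_mul hC.le, Pi.smul_apply, smul_eq_mul]
  have h2 : posterior prior x = (niwMeasure κ m S d Set.univ)⁻¹ • niwMeasure κ m S d := by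
    rw [posterior, h1, normalize_smul _ (ENNReal.ofReal_pos.2 hC).ne' ENNReal.ofReal_ne_top]
  exact niw_mean hκ hd m (fun _ => r (t + 1)) hS _ h2

end Posterior

/-! ### Likelihood and priors -/

section Likelihood

variable {k n : ℕ}

lemma dotProduct_mulVec_eq_trace (P : Matrix (Fin k) (Fin k) ℝ) (v : Fin k → ℝ) :
    v ⬝ᵥ P *ᵥ v = (P * Matrix.vecMulVec v v).trace := by
  rw [Matrix.mul_vecMulVec, Matrix.trace_vecMulVec, dotProduct_comm]

lemma scatterD_eq (hn : 1 < n) (x : Fin n → Fin k → ℝ) :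
    scatterD x = ∑ i, Matrix.vecMulVec (x i - sampleMean x) (x i - sampleMean x) := by
  have : (n : ℝ) - 1 ≠ 0 := by
    have : (1 : ℝ) < n := by exact_mod_cast hn
    linarith
  rw [scatterD, sampleCov, smul_smul, mul_inv_cancel₀ this, one_smul]

/-- Deviations from the sample mean sum to zero, so the cross terms vanish. -/
lemma sum_vecMulVec_sub (hn : 1 < n) (x : Fin n → Fin k → ℝ) (μ : Fin k → ℝ) :
    ∑ i, Matrix.vecMulVec (x i - μ) (x i - μ) =
      (n : ℝ) • Matrix.vecMulVec (μ - sampleMean x) (μ - sampleMean x) + scatterD x := by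
  have hn0 : (n : ℝ) ≠ 0 := by positivity
  have hsum : ∀ a, ∑ i, x i a = n * sampleMean x a := fun a => by
    rw [sampleMean, Pi.smul_apply, Finset.sum_apply, smul_eq_mul, mul_inv_cancel_left₀ hn0]
  rw [scatterD_eq hn]
  ext a b
  simp only [Matrix.sum_apply, Matrix.add_apply, Matrix.smul_apply, Matrix.vecMulVec_apply,
    Pi.sub_apply, smul_eq_mul, sub_mul, mul_sub, Finset.sum_sub_distrib, ← Finset.sum_mul,
    ← Finset.mul_sum, hsum, Finset.sum_const, Finset.card_univ, Fintype.card_fin, nsmul_eq_mul]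
  ring

lemma posSemidef_scatterD (hn : 1 < n) (x : Fin n → Fin k → ℝ) : (scatterD x).PosSemidef := by
  rw [scatterD_eq hn]
  refine Matrix.posSemidef_sum _ fun i _ => ?_
  simpa using Matrix.posSemidef_vecMulVec_self_star (x i - sampleMean x)

lemma likelihood_eq (hn : 1 < n) (x : Fin n → Fin k → ℝ) (μ : Fin k → ℝ)
    {Sig : Matrix (Fin k) (Fin k) ℝ} (hSig : Sig.PosDef) :
    likelihood x μ Sig = ((2 * Real.pi) ^ (-(k : ℝ) / 2)) ^ n * Sig.det ^ (-(n : ℝ) / 2) *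
      Real.exp (-(n * ((μ - sampleMean x) ⬝ᵥ Sig⁻¹ *ᵥ (μ - sampleMean x)) +
        (Sig⁻¹ * scatterD x).trace) / 2) := by
  have hq : ∑ i, (x i - μ) ⬝ᵥ Sig⁻¹ *ᵥ (x i - μ) =
      n * ((μ - sampleMean x) ⬝ᵥ Sig⁻¹ *ᵥ (μ - sampleMean x)) +
        (Sig⁻¹ * scatterD x).trace := by
    simp only [dotProduct_mulVec_eq_trace]
    rw [← Matrix.trace_sum, ← Matrix.mul_sum, sum_vecMulVec_sub hn, mul_add, Matrix.trace_add,
      Matrix.mul_smul, Matrix.trace_smul, smul_eq_mul]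
  simp only [likelihood, gaussianDensity]
  rw [Finset.prod_mul_distrib, Finset.prod_mul_distrib, ← Real.exp_sum, Finset.prod_const,
    Finset.prod_const, Finset.card_univ, Fintype.card_fin, ← hq, ← Finset.sum_div,
    Finset.sum_neg_distrib, ← Real.rpow_natCast (Sig.det ^ _), ← Real.rpow_mul hSig.det_pos.le]
  congr 3
  ring

lemma likelihood_mul_diffusePrior (hn : 1 < n) (x : Fin n → Fin k → ℝ)
    {θ : (Fin k → ℝ) × SymCoord k} (hθ : θ ∈ posDefParams k) :
    likelihood x θ.1 (symMatrix θ.2) * diffusePrior θ.1 (symMatrix θ.2) =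
      ((2 * Real.pi) ^ (-(k : ℝ) / 2)) ^ n *
        niwDensity n (sampleMean x) (scatterD x) (n + k) θ := by
  have hdet : 0 < (symMatrix θ.2).det := Matrix.PosDef.det_pos hθ
  rw [likelihood_eq hn x θ.1 hθ, diffusePrior, niwDensity,
    show -((n : ℝ) + k + 1) / 2 = -(n : ℝ) / 2 + -((k : ℝ) + 1) / 2 by ring, Real.rpow_add hdet]
  ring

/-- The smallest Gamma argument is `a - (k - 1) / 2`. -/
lemma multiGamma_pos {a : ℝ} (ha : (k : ℝ) - 1 < 2 * a) : 0 < multiGamma k a := by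
  refine mul_pos (Real.rpow_pos_of_pos Real.pi_pos _) (Finset.prod_pos fun i _ =>
    Real.Gamma_pos_of_pos ?_)
  have : (i : ℝ) + 1 ≤ k := by exact_mod_cast i.isLt
  linarith

/-- Completing the square in `μ`: the likelihood and prior terms merge around the weighted mean,
leaving the rank-one term of `scatterC`. -/
lemma smul_vecMulVec_add_smul_vecMulVec {r₀ : ℝ} (hr : 0 < r₀) (m₀ μ : Fin k → ℝ)
    (x : Fin n → Fin k → ℝ) :
    (n : ℝ) • Matrix.vecMulVec (μ - sampleMean x) (μ - sampleMean x) +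
        r₀ • Matrix.vecMulVec (μ - m₀) (μ - m₀) =
      ((n : ℝ) + r₀) • Matrix.vecMulVec (μ - meanC m₀ r₀ x) (μ - meanC m₀ r₀ x) +
        ((n : ℝ) * r₀ / ((n : ℝ) + r₀)) •
          Matrix.vecMulVec (m₀ - sampleMean x) (m₀ - sampleMean x) := by
  have hnr : (n : ℝ) + r₀ ≠ 0 := by positivity
  ext a b
  simp only [Matrix.add_apply, Matrix.smul_apply, Matrix.vecMulVec_apply, Pi.sub_apply, meanC,
    Pi.smul_apply, Pi.add_apply, smul_eq_mul]
  field_simp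
  ring

lemma likelihood_mul_conjugatePrior (hn : 1 < n) (x : Fin n → Fin k → ℝ) (m₀ : Fin k → ℝ)
    {r₀ d₀ : ℝ} (hr : 0 < r₀) (hd : 2 * (k : ℝ) < d₀) {S₀ : Matrix (Fin k) (Fin k) ℝ}
    (hS : S₀.PosDef) : ∃ C : ℝ, 0 < C ∧ ∀ θ ∈ posDefParams k,
      likelihood x θ.1 (symMatrix θ.2) * conjugatePrior m₀ r₀ d₀ S₀ θ.1 (symMatrix θ.2) =
        C * niwDensity (n + r₀) (meanC m₀ r₀ x) (scatterC m₀ r₀ S₀ x) (n + d₀) θ := by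
  have hG : 0 < multiGamma k ((d₀ - k - 1) / 2) := multiGamma_pos (by linarith)
  -- The three normalising constants; `r₀⁻¹ ^ k` comes from `det (r₀⁻¹ • Sig)`.
  refine ⟨((2 * Real.pi) ^ (-(k : ℝ) / 2)) ^ n * ((2 * Real.pi) ^ (-(k : ℝ) / 2) *
    (r₀⁻¹ ^ k) ^ (-(1 : ℝ) / 2)) * (S₀.det ^ ((d₀ - k - 1) / 2) /
      (2 ^ ((k : ℝ) * (d₀ - k - 1) / 2) * multiGamma k ((d₀ - k - 1) / 2))), ?_, fun θ hθ => ?_⟩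
  · have := hS.det_pos
    positivity
  set Sig := symMatrix θ.2 with hSig
  have hPD : Sig.PosDef := hθ
  have hdet : 0 < Sig.det := hPD.det_pos
  have hinv : (r₀⁻¹ • Sig)⁻¹ = r₀ • Sig⁻¹ := by
    refine Matrix.inv_eq_right_inv ?_
    rw [smul_mul_smul_comm, inv_mul_cancel₀ hr.ne', one_smul,
      Matrix.mul_nonsing_inv _ (isUnit_iff_ne_zero.2 hdet.ne')]
  have hexp : (n * ((θ.1 - sampleMean x) ⬝ᵥ Sig⁻¹ *ᵥ (θ.1 - sampleMean x)) +
        (Sig⁻¹ * scatterD x).trace) + r₀ * ((θ.1 - m₀) ⬝ᵥ Sig⁻¹ *ᵥ (θ.1 - m₀)) +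
        (Sig⁻¹ * S₀).trace =
      (n + r₀) * ((θ.1 - meanC m₀ r₀ x) ⬝ᵥ Sig⁻¹ *ᵥ (θ.1 - meanC m₀ r₀ x)) +
        (Sig⁻¹ * scatterC m₀ r₀ S₀ x).trace := by
    have h := congrArg (fun M => (Sig⁻¹ * M).trace)
      (smul_vecMulVec_add_smul_vecMulVec hr m₀ θ.1 x)
    simp only [mul_add, Matrix.mul_smul, Matrix.trace_add, Matrix.trace_smul, smul_eq_mul,
      ← dotProduct_mulVec_eq_trace] at h
    simp only [scatterC, mul_add, Matrix.mul_smul, Matrix.trace_add, Matrix.trace_smul,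
      smul_eq_mul, ← dotProduct_mulVec_eq_trace]
    linarith
  have hsplit : ∀ a b c : ℝ, Real.exp (-(a + b + c) / 2) =
      Real.exp (-a / 2) * Real.exp (-b / 2) * Real.exp (-c / 2) := fun a b c => by
    rw [← Real.exp_add, ← Real.exp_add]
    congr 1
    ring
  rw [likelihood_eq hn x θ.1 hPD, conjugatePrior, gaussianDensity, invWishartDensity, niwDensity,
    ← hSig, ← hexp, hinv, Matrix.det_smul, Fintype.card_fin,
    Real.mul_rpow (by positivity) hdet.le,
    show -((n : ℝ) + d₀ + 1) / 2 = -(n : ℝ) / 2 + -(1 : ℝ) / 2 + -d₀ / 2 by ring,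
    Real.rpow_add hdet, Real.rpow_add hdet, hsplit, Matrix.smul_mulVec, dotProduct_smul, smul_eq_mul]
  ring

lemma posDef_scatterC (hn : 1 < n) (x : Fin n → Fin k → ℝ) (m₀ : Fin k → ℝ)
    {r₀ : ℝ} (hr : 0 < r₀) {S₀ : Matrix (Fin k) (Fin k) ℝ} (hS : S₀.PosDef) :
    (scatterC m₀ r₀ S₀ x).PosDef := by
  refine (Matrix.PosDef.posSemidef_add (posSemidef_scatterD hn x) hS).add_posSemidef ?_
  have h := Matrix.posSemidef_vecMulVec_self_star (m₀ - sampleMean x)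
  rw [star_trivial] at h
  exact h.smul (by positivity)

end Likelihood

end BayesPortfolio

theorem theorem3 {k n T t : ℕ} (hk : 0 < k) (hn : k < n) (ht : t < T)
    (γ W : ℝ) (r : ℕ → ℝ) (hγ : 0 < γ) (hW : W ≠ 0)
    (hr : ∀ i ∈ Finset.Icc (t + 1) T, 1 + r i ≠ 0)
    (x : Fin n → Fin k → ℝ) :
    -- the weights `w_t` are the unique optimal ones
    (∀ (μ : Fin k → ℝ) (Sig : Matrix (Fin k) (Fin k) ℝ), Sig.PosDef → ∀ v : Fin k → ℝ,
      IsOptimalWeight γ r T t W μ Sig v ↔ v = weight γ r T t W μ Sig) ∧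
    -- diffuse prior
    (IsUnit (scatterD x).det →
      HasPosteriorMean diffusePrior x (weight γ r T t W)
        ((coefC γ r T t W * ((n : ℝ) - 1)) •
          ((scatterD x)⁻¹ *ᵥ fun i => sampleMean x i - r (t + 1)))) ∧
    -- conjugate prior
    (∀ (m₀ : Fin k → ℝ) (r₀ d₀ : ℝ) (S₀ : Matrix (Fin k) (Fin k) ℝ),
      0 < r₀ → 2 * (k : ℝ) < d₀ → S₀.PosDef →
      HasPosteriorMean (conjugatePrior m₀ r₀ d₀ S₀) x (weight γ r T t W)
        ((coefC γ r T t W * ((n : ℝ) + d₀ - k - 1)) •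
          ((scatterC m₀ r₀ S₀ x)⁻¹ *ᵥ fun i => meanC m₀ r₀ x i - r (t + 1)))) := by
  have hn1 : 1 < n := by omega
  have hkn : (k : ℝ) < n := by exact_mod_cast hn
  have hn0 : (0 : ℝ) < n := (Nat.cast_nonneg k).trans_lt hkn
  refine ⟨fun μ Sig hSig v => isOptimalWeight_iff μ hSig hγ hW ht hr v, fun hdet => ?_,
    fun m₀ r₀ d₀ S₀ hr₀ hd₀ hS₀ => ?_⟩
  · have hPD : (scatterD x).PosDef :=
      (posSemidef_scatterD hn1 x).posDef_iff_isUnit.2 ((Matrix.isUnit_iff_isUnit_det _).2 hdet)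
    -- With `d = n + k`, properness `2k < d` is exactly `k < n`, and `d - k - 1` is `n - 1`.
    have h := hasPosteriorMean_weight (κ := n) (d := n + k) hn0 (by linarith) (sampleMean x) hPD
      (by positivity) (fun θ hθ => likelihood_mul_diffusePrior hn1 x hθ) γ W r T t
    rwa [add_sub_cancel_right] at h
  · obtain ⟨C, hC, hprior⟩ := likelihood_mul_conjugatePrior hn1 x m₀ hr₀ hd₀ hS₀
    exact hasPosteriorMean_weight (κ := n + r₀) (d := n + d₀) (by positivity) (by linarith)
      (meanC m₀ r₀ x) (posDef_scatterC hn1 x m₀ hr₀ hS₀) hC hprior γ W r T t
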